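/- **Setting.** Let $A,G,\Gamma,Q\in\mathbb R^{n\times n}$, $B\in\mathbb R^{n\times r}$, $R\in\mathbb R^{r\times r}$, $\eta\in\mathbb R^n$, $\rho\in\mathbb R$, with $R>0$ and $Q\ge 0$ symmetric. Let $C_{\rho/2}$ be the space of continuous $g:[0,\infty)\to\mathbb R^n$ with $\int_0^\infty e^{-\rho t}\|g(t)\|^2dt<\infty$, and let $f,\sigma\in C_{\rho/2}$. There are $N$ agents, $$dx_i=[Ax_i+Bu_i+Gx^{(N)}+f]\,dt+\sigma\,dW_i,\quad x_i(0)=x_{i0},\quad x^{(N)}=\tfrac1N\sum_{j=1}^N x_j,$$ where $W_1,\dots,W_N$ are independent standard real Brownian motions, the $x_{i0}$ are mutually independent, square integrable, with common mean $\bar x_0$, and $\{x_{i0}\}_i$ is independent of $\{W_i\}_i$. Put $\hat Q=(I-\Gamma)^TQ(I-\Gamma)$, $Q_\Gamma=\Gamma^TQ+Q\Gamma-\Gamma^TQ\Gamma$, $\bar\eta=Q\eta-\Gamma^TQ\eta$. Assume that $(A-\frac\rho2I,\sqrt Q)$ and $(A+G-\frac\rho2I,\sqrt Q(I-\Gamma))$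 are detectable. Assume $f=0$ and $G=0$. **First set of laws.** Let $P\ge0$ and $\Pi\ge0$ satisfy $$\rho P=A^TP+PA-PBR^{-1}B^TP+Q,\qquad \rho\Pi=(A+G)^T\Pi+\Pi(A+G)-\Pi BR^{-1}B^T\Pi+\hat Q,$$ let $s,\bar x\in C_{\rho/2}$ satisfy, on $[0,\infty)$, $$\rho s=\dot s+[A+G-BR^{-1}B^T\Pi]^Ts+\Pi f-\bar\eta,\qquad \dot{\bar x}=(A+G)\bar x-BR^{-1}B^T(\Pi\bar x+s)+f,\quad \bar x(0)=\bar x_0,$$ and let $$\hat u_i(t)=-R^{-1}B^T[Px_i(t)+(\Pi-P)\bar x(t)+s(t)],\qquad i=1,\dots,N.$$ **Second set of laws (Huang, Caines and Malhamé).** With $\bar A=A-BR^{-1}B^TP$, let the matrix $\bar K$ and the functions $x^\dagger,\phi\in C_{\rho/2}$ satisfy $$\rho\bar K=\bar K\bar A+\bar A^T\bar K-\bar KBR^{-1}B^T\bar K^T-Q_\Gamma,$$ $$\dot x^\dagger=\bar Ax^\dagger-BR^{-1}B^T(\bar Kx^\dagger+\phi),\quad x^\dagger(0)=\bar x_0,\qquad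 \dot\phi=-[A-BR^{-1}B^T(P+\bar K)-\rho I]^T\phi+\bar\eta,$$ and let $$\breve u_i(t)=-R^{-1}B^T\big(Px_i(t)+\bar K x^\dagger(t)+\phi(t)\big),\qquad i=1,\dots,N.$$ **Claim.** (a) The triple $(\Pi-P,\bar x,s)$ is a solution $(\bar K,x^\dagger,\phi)$ of the second system. If $P+\bar K\ge0$, or if all eigenvalues of $A-BR^{-1}B^T(P+\bar K)-\frac\rho2I$ have negative real part, then $\bar K=\Pi-P$ and $\phi=s$ on $[0,\infty)$. In every case $x^\dagger=\bar x$ on $[0,\infty)$. (b) The set of laws $\{\hat u_1,\dots,\hat u_N\}$ is a representation of $\{\breve u_1,\dots,\breve u_N\}$. That is, both sets of laws generate the same state trajectory $(x_1,\dots,x_N)$, which for each of them exists and is unique up to indistinguishability among continuous processes adapted to the completed filtration generated by all $x_{j0}$ and $W_j$; on this trajectory they have the same open-loop values, i.e. almost surely $\hat u_i(t)=\breve u_i(t)$ for all $t\ge0$ and all $i$; and both are admissible: $u_i(t)$ is adapted to $\sigma(x_i(\tau),0\le\tau\le t)$ and $\mathbb E\int_0^\infty e^{-\rho t}\|u_i(t)\|^2dt<\infty$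 for all $i$. -/

import Mathlib

open MeasureTheory ProbabilityTheory Filter Topology Set
open scoped NNReal ENNReal Matrix

noncomputable section

namespace MeanFieldLQ

/-- `ℝⁿ` with the Euclidean norm. -/
abbrev Vec (n : ℕ) := EuclideanSpace ℝ (Fin n)

/-- Real matrices. -/
abbrev Mat (m n : ℕ) := Matrix (Fin m) (Fin n) ℝ

/-- Matrix-vector product on Euclidean spaces. -/
abbrev act {m n : ℕ} (A : Mat m n) (x : Vec n) : Vec m := Matrix.toEuclideanLin A x

/-- All eigenvalues of the real matrix `A` lie in the open left half-plane. -/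
def IsHurwitz {n : ℕ} (A : Mat n n) : Prop :=
  ∀ z ∈ spectrum ℂ (A.map Complex.ofReal), z.re < 0

/-- `(A, C)` is detectable: some output injection makes `A` Hurwitz. -/
def IsDetectable {n p : ℕ} (A : Mat n n) (C : Mat p n) : Prop :=
  ∃ L : Mat n p, IsHurwitz (A + L * C)

section
open scoped MatrixOrder
/-- The positive semidefinite square root of a positive semidefinite matrix. -/
def sqrtMat {n : ℕ} (Q : Mat n n) : Mat n n := CFC.sqrt Q
end

/-- The space `C_{ρ/2}([0,∞), ℝⁿ)`; functions are represented by their values on `[0,∞)`. -/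
def InCrho (ρ : ℝ) {n : ℕ} (g : ℝ → Vec n) : Prop :=
  ContinuousOn g (Ici 0) ∧ IntegrableOn (fun t => Real.exp (-ρ * t) * ‖g t‖ ^ 2) (Ici 0)

/-- The data of the linear quadratic mean field model
`dxᵢ = [A xᵢ + B uᵢ + G x⁽ᴺ⁾ + f] dt + σ dWᵢ`,
`Jᵢ = E ∫ e^{-ρt} (‖xᵢ - Γ x⁽ᴺ⁾ - η‖²_Q + ‖uᵢ‖²_R) dt`. -/
structure Model (n r : ℕ) where
  A : Mat n n
  B : Mat n r
  G : Mat n n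
  f : ℝ → Vec n
  σ : ℝ → Vec n
  Q : Mat n n
  R : Mat r r
  Γ : Mat n n
  η : Vec n
  ρ : ℝ

namespace Model

variable {n r : ℕ} (M : Model n r)

/-- `B R⁻¹ Bᵀ`. -/
def S : Mat n n := M.B * M.R⁻¹ * M.Bᵀ

/-- `Q_Γ = ΓᵀQ + QΓ - ΓᵀQΓ`. -/
def QΓ : Mat n n := M.Γᵀ * M.Q + M.Q * M.Γ - M.Γᵀ * M.Q * M.Γ

/-- `Q̂ = (I - Γ)ᵀ Q (I - Γ)`. -/
def Qhat : Mat n n := (1 - M.Γ)ᵀ * M.Q * (1 - M.Γ)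

/-- `η̄ = Qη - ΓᵀQη`. -/
def ηbar : Vec n := act (M.Q - M.Γᵀ * M.Q) M.η

/-- `Ā = A - B R⁻¹ Bᵀ P`. -/
def Abar (P : Mat n n) : Mat n n := M.A - M.S * P

/-- `ρ P = AᵀP + PA - P B R⁻¹ Bᵀ P + Q`. -/
def RiccatiP (P : Mat n n) : Prop :=
  M.ρ • P = M.Aᵀ * P + P * M.A - P * M.S * P + M.Q

/-- `ρ Π = (A+G)ᵀΠ + Π(A+G) - Π B R⁻¹ Bᵀ Π + Q̂`. -/
def RiccatiPi (Pi : Mat n n) : Prop :=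
  M.ρ • Pi = (M.A + M.G)ᵀ * Pi + Pi * (M.A + M.G) - Pi * M.S * Pi + M.Qhat

/-- `s, x̄ ∈ C_{ρ/2}` solve `ρ s = ṡ + [A + G - B R⁻¹ Bᵀ Π]ᵀ s + Π f - η̄` and
`dx̄/dt = (A + G) x̄ - B R⁻¹ Bᵀ (Π x̄ + s) + f`, `x̄(0) = x̄₀`. -/
def SolvesMeanField (xbar0 : Vec n) (Pi : Mat n n) (s xbar : ℝ → Vec n) : Prop :=
  InCrho M.ρ s ∧ InCrho M.ρ xbar ∧ xbar 0 = xbar0 ∧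
  (∀ t ∈ Ici (0 : ℝ), HasDerivWithinAt s
    (M.ρ • s t - act (M.A + M.G - M.S * Pi)ᵀ (s t) - act Pi (M.f t) + M.ηbar) (Ici 0) t) ∧
  (∀ t ∈ Ici (0 : ℝ), HasDerivWithinAt xbar
    (act (M.A + M.G) (xbar t) - act M.S (act Pi (xbar t) + s t) + M.f t) (Ici 0) t)

/-- The system that determines the feedback laws of Huang, Caines and Malhamé:
`ρ K̄ = K̄ Ā + Āᵀ K̄ - K̄ B R⁻¹ Bᵀ K̄ᵀ - Q_Γ`, and `x†, φ ∈ C_{ρ/2}` with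
`dx†/dt = Ā x† - B R⁻¹ Bᵀ (K̄ x† + φ)`, `x†(0) = x̄₀`,
`dφ/dt = -[A - B R⁻¹ Bᵀ (P + K̄) - ρ I]ᵀ φ + η̄`. -/
def SolvesHCM (xbar0 : Vec n) (P K : Mat n n) (xdag φ : ℝ → Vec n) : Prop :=
  M.ρ • K = K * M.Abar P + (M.Abar P)ᵀ * K - K * M.S * Kᵀ - M.QΓ ∧
  InCrho M.ρ xdag ∧ InCrho M.ρ φ ∧ xdag 0 = xbar0 ∧
  (∀ t ∈ Ici (0 : ℝ), HasDerivWithinAt xdag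
    (act (M.Abar P) (xdag t) - act M.S (act K (xdag t) + φ t)) (Ici 0) t) ∧
  (∀ t ∈ Ici (0 : ℝ), HasDerivWithinAt φ
    (-(act (M.A - M.S * (P + K) - M.ρ • (1 : Mat n n))ᵀ (φ t)) + M.ηbar) (Ici 0) t)

/-- The decentralized law `û(t, x) = -R⁻¹Bᵀ[P x + (Π - P) x̄(t) + s(t)]`, used by each agent. -/
def uhat (P Pi : Mat n n) (xbar s : ℝ → Vec n) (t : ℝ≥0) (x : Vec n) : Vec r :=
  -(act (M.R⁻¹ * M.Bᵀ) (act P x + act (Pi - P) (xbar t) + s t))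

/-- The law `ŭ(t, x) = -R⁻¹Bᵀ(P x + s̄(t))` with `s̄ = K̄ x† + φ`, used by each agent. -/
def ubreve (P K : Mat n n) (xdag φ : ℝ → Vec n) (t : ℝ≥0) (x : Vec n) : Vec r :=
  -(act (M.R⁻¹ * M.Bᵀ) (act P x + (act K (xdag t) + φ t)))

end Model

variable {Ω : Type*} [MeasurableSpace Ω]

/-- Assumptions on the initial states and on the noise: independent standard Brownian motions
`Wᵢ`; mutually independent square integrable initial states with common mean `xbar0`; the two
families are independent of each other. -/
structure NoiseAssumption (μ : Measure Ω) {N n : ℕ} (xbar0 : Vec n) (x0 : Fin N → Ω → Vec n)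
    (W : Fin N → ℝ≥0 → Ω → ℝ) : Prop where
  measurable_init : ∀ i, Measurable (x0 i)
  measurable_noise : ∀ i t, Measurable (W i t)
  memLp_init : ∀ i, MemLp (x0 i) 2 μ
  mean_init : ∀ i, ∫ ω, x0 i ω ∂μ = xbar0
  indep_init : iIndepFun x0 μ
  brownian : ∀ i, IsBrownianReal (W i) μ
  indep_noise : iIndepFun (fun i ω (t : ℝ≥0) => W i t ω) μ
  indep_init_noise :
    IndepFun (fun ω i => x0 i ω) (fun ω (p : Fin N × ℝ≥0) => W p.1 p.2 ω) μ

/-- `I` is (a continuous version of) the stochastic integral `I(t) = ∫₀ᵗ σ dW` of the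
deterministic continuous function `σ`: it has continuous paths, and `I(t)` is the mean square
limit of the left endpoint sums over the uniform partitions of `[0,t]`. -/
structure IsWienerIntegral (μ : Measure Ω) {n : ℕ} (σ : ℝ → Vec n) (W : ℝ≥0 → Ω → ℝ)
    (I : ℝ≥0 → Ω → Vec n) : Prop where
  aestronglyMeasurable : ∀ t, AEStronglyMeasurable (I t) μ
  continuous : ∀ᵐ ω ∂μ, Continuous fun t => I t ω
  tendsto : ∀ t : ℝ≥0, Tendsto (fun m : ℕ => eLpNorm (fun ω =>
    ∑ k ∈ Finset.range (m + 1),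
      (W (t * ((k : ℝ≥0) + 1) / (m + 1)) ω - W (t * (k : ℝ≥0) / (m + 1)) ω) •
        σ ((t * (k : ℝ≥0) / (m + 1) : ℝ≥0) : ℝ) - I t ω) 2 μ) atTop (𝓝 0)

/-- `F_t`, generated by all initial states and all Brownian motions up to time `t`. -/
abbrev pastSigma {N n : ℕ} (x0 : Fin N → Ω → Vec n) (W : Fin N → ℝ≥0 → Ω → ℝ) (t : ℝ≥0) :
    MeasurableSpace Ω :=
  ⨆ i : Fin N, MeasurableSpace.comap (x0 i) inferInstance ⊔
    ⨆ s : Iic t, MeasurableSpace.comap (W i s) inferInstance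

/-- A set of decentralized feedback laws: agent `i` applies `uᵢ(t) = u i t (xᵢ(t))`. -/
abbrev Laws (N n r : ℕ) := Fin N → ℝ≥0 → Vec n → Vec r

/-- Drift of agent `i` at time `t` under the laws `u`, at the joint state `x`. -/
def drift {N n r : ℕ} (M : Model n r) (u : Laws N n r) (i : Fin N) (t : ℝ≥0)
    (x : Fin N → Vec n) : Vec n :=
  act M.A (x i) + act M.B (u i t (x i)) + act M.G ((N : ℝ)⁻¹ • ∑ j, x j) + M.f t

/-- `X` is a state trajectory of the closed loop under the laws `u`: a continuous process,
adapted to the completion of `F_t`, that solves the closed-loop stochastic differential equations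
`xᵢ(t) = xᵢ₀ + ∫₀ᵗ [A xᵢ + B uᵢ + G x⁽ᴺ⁾ + f] dτ + ∫₀ᵗ σ dWᵢ`. -/
structure IsTrajectory {N n r : ℕ} (M : Model n r) (μ : Measure Ω) (x0 : Fin N → Ω → Vec n)
    (W : Fin N → ℝ≥0 → Ω → ℝ) (u : Laws N n r) (X : Fin N → ℝ≥0 → Ω → Vec n) : Prop where
  adapted : ∀ i t, AEStronglyMeasurable[pastSigma x0 W t] (X i t) μ
  continuous : ∀ i, ∀ᵐ ω ∂μ, Continuous fun t => X i t ω
  equation : ∀ i, ∃ I : ℝ≥0 → Ω → Vec n, IsWienerIntegral μ M.σ (W i) I ∧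
    ∀ᵐ ω ∂μ, ∀ t : ℝ≥0,
      IntervalIntegrable (fun τ : ℝ => drift M u i τ.toNNReal fun j => X j τ.toNNReal ω)
        volume 0 t ∧
      X i t ω = x0 i ω
        + (∫ τ in (0 : ℝ)..t, drift M u i τ.toNNReal fun j => X j τ.toNNReal ω) + I t ω

/-- The laws `u` generate the unique (up to indistinguishability) state trajectory `X`. -/
def GeneratesUnique {N n r : ℕ} (M : Model n r) (μ : Measure Ω) (x0 : Fin N → Ω → Vec n)
    (W : Fin N → ℝ≥0 → Ω → ℝ) (u : Laws N n r) (X : Fin N → ℝ≥0 → Ω → Vec n) : Prop :=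
  IsTrajectory M μ x0 W u X ∧
  ∀ Y, IsTrajectory M μ x0 W u Y → ∀ i, ∀ᵐ ω ∂μ, ∀ t, Y i t ω = X i t ω

/-- The open-loop values `uᵢ(t)` of the laws `u` on the trajectory `X` lie in the decentralized
control sets: `uᵢ(t)` is adapted to `σ(xᵢ(s), s ≤ t)` and `E ∫₀^∞ e^{-ρt} ‖uᵢ(t)‖² dt < ∞`. -/
def IsAdmissible {N n r : ℕ} (M : Model n r) (μ : Measure Ω) (u : Laws N n r)
    (X : Fin N → ℝ≥0 → Ω → Vec n) : Prop :=
  ∀ i : Fin N,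
    (∀ t : ℝ≥0, Measurable[⨆ s : Iic t, MeasurableSpace.comap (X i s) inferInstance]
      fun ω => u i t (X i t ω)) ∧
    ∫⁻ ω, ∫⁻ t in Ici (0 : ℝ), ENNReal.ofReal
      (Real.exp (-M.ρ * t) * ‖u i t.toNNReal (X i t.toNNReal ω)‖ ^ 2) ∂volume ∂μ < ∞

/-- The laws `u` are a representation of the laws `v`: both are admissible, both generate the same
unique state trajectory, and both have the same open-loop values on this trajectory. -/
def IsRepresentation {N n r : ℕ} (M : Model n r) (μ : Measure Ω) (x0 : Fin N → Ω → Vec n)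
    (W : Fin N → ℝ≥0 → Ω → ℝ) (u v : Laws N n r) : Prop :=
  ∃ X : Fin N → ℝ≥0 → Ω → Vec n,
    IsAdmissible M μ u X ∧ IsAdmissible M μ v X ∧
    GeneratesUnique M μ x0 W u X ∧ GeneratesUnique M μ x0 W v X ∧
    ∀ i, ∀ᵐ ω ∂μ, ∀ t, u i t (X i t ω) = v i t (X i t ω)

end MeanFieldLQ

end

open MeanFieldLQ

open MeanFieldLQ

/-! The second system is the first one seen through the Riccati equation for `P`. Write `S` for `B
R⁻¹ Bᵀ`. Detectability makes `Ā - ρ/2` Hurwitz, and `K̄ᵀ - K̄` solves a homogeneous Sylvester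
equation for that matrix, so `K̄` is symmetric (`Model.transpose_eq_of_solvesHCM`). Since `Q̂ = Q -
Q_Γ` and `G = 0`, the matrix `P + K̄` then solves the Riccati equation of `Π`. If it is positive
semidefinite, detectability makes it stabilizing; two stabilizing solutions coincide, again by a
Sylvester equation. After that `φ - s` solves an anti-stable adjoint equation, which has no nonzero
solution in `C_{ρ/2}`.

Without a stabilizing `P + K̄` the matrices may differ, but the laws may not. The state `x†` and the
costate `ν = (P + K̄) x† + φ` solve a Hamiltonian system in which neither `P` nor `K̄` occurs. For
two solutions with differences `y` and `l`, the function `-e^{-ρt}⟨y, l⟩` has derivative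
`e^{-ρt}(⟨l, S l⟩ + ⟨y, Q̂ y⟩) ≥ 0`, is integrable and starts at 0, so it vanishes. Thus `S l = 0`,
hence `y = 0` and `R⁻¹Bᵀ l = 0` (`hamiltonian_unique`, `Model.gain_eq_zero`). The two laws are
therefore equal as functions of time and state, and the representation claim becomes well-posedness
and admissibility of a single law.

With `G = 0` the agents decouple into affine equations with matrix `Ā`, solved by `x†(t) +
e^{tĀ}(xᵢ₀ - x̄₀ + Jᵢ(t))`, where `Jᵢ(t) = ∫₀ᵗ e^{-uĀ} σ dWᵢ`. The Wiener integral is built as a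
closed isometric graph between `L²` spaces; Doob's inequality and Borel–Cantelli give a continuous
version, and summation by parts shows that the formula solves the integral equation. Pathwise
uniqueness is that of a linear ODE, and finite discounted energy follows from a Lyapunov function,
the isometry and Tonelli. -/

namespace MeanFieldLQ

/-! ### Matrices acting on Euclidean vectors. -/

section Action

variable {m n p : ℕ}

lemma act_mul (A : Mat m n) (B : Mat n p) (x : Vec p) : act (A * B) x = act A (act B x) := by
  ext i
  simp [Matrix.mulVec_mulVec]

lemma act_add_left (A B : Mat m n) (x : Vec n) : act (A + B) x = act A x + act B x := by
  simp [act]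

lemma act_sub_left (A B : Mat m n) (x : Vec n) : act (A - B) x = act A x - act B x := by
  simp [act]

lemma act_smul_left (c : ℝ) (A : Mat m n) (x : Vec n) : act (c • A) x = c • act A x := by
  simp [act]

lemma act_one (x : Vec n) : act (1 : Mat n n) x = x := by
  ext i
  simp

lemma act_zero_left (x : Vec n) : act (0 : Mat m n) x = 0 := by
  simp [act]

lemma inner_eq_dotProduct (x y : Vec n) : inner ℝ x y = x.ofLp ⬝ᵥ y.ofLp := by
  simp [PiLp.inner_apply, dotProduct, mul_comm]

lemma inner_act_left (A : Mat m n) (x : Vec n) (y : Vec m) :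
    inner ℝ (act A x) y = inner ℝ x (act Aᵀ y) := by
  rw [inner_eq_dotProduct, inner_eq_dotProduct]
  simp [Matrix.dotProduct_mulVec, Matrix.vecMul_transpose]

lemma inner_act_right (A : Mat m n) (x : Vec m) (y : Vec n) :
    inner ℝ x (act A y) = inner ℝ (act Aᵀ x) y := by
  rw [inner_act_left, Matrix.transpose_transpose]

lemma transpose_eq_of_posSemidef {A : Mat n n} (hA : A.PosSemidef) : Aᵀ = A := by
  simpa [Matrix.IsHermitian, Matrix.conjTranspose_eq_transpose_of_trivial] using hA.isHermitian

lemma inner_act_self_nonneg {A : Mat n n} (hA : A.PosSemidef) (x : Vec n) :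
    0 ≤ inner ℝ x (act A x) := by
  rw [inner_eq_dotProduct]
  simpa using hA.dotProduct_mulVec_nonneg x.ofLp

lemma act_eq_zero_of_inner_eq_zero {A : Mat n n} (hA : A.PosSemidef) {x : Vec n}
    (h : inner ℝ x (act A x) = 0) : act A x = 0 := by
  rw [inner_eq_dotProduct] at h
  have := (hA.dotProduct_mulVec_zero_iff x.ofLp).1 (by simpa using h)
  ext i
  simpa using congrFun this i

/-- The continuous linear map of a matrix. -/
noncomputable def actCLM (A : Mat m n) : Vec n →L[ℝ] Vec m :=
  LinearMap.toContinuousLinearMap (Matrix.toEuclideanLin A)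

@[simp] lemma actCLM_apply (A : Mat m n) (x : Vec n) : actCLM A x = act A x := rfl

lemma continuous_act (A : Mat m n) : Continuous fun x : Vec n => act A x :=
  (actCLM A).continuous

lemma norm_act_le (A : Mat m n) (x : Vec n) : ‖act A x‖ ≤ ‖actCLM A‖ * ‖x‖ :=
  (actCLM A).le_opNorm x

end Action

/-! ### Hurwitz matrices, Riccati and Sylvester equations. -/

section Hurwitz

variable {n p : ℕ}

lemma mem_spectrum_iff_exists_mulVec (A : Matrix (Fin n) (Fin n) ℂ) (z : ℂ) :
    z ∈ spectrum ℂ A ↔ ∃ v : Fin n → ℂ, v ≠ 0 ∧ A *ᵥ v = z • v := by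
  rw [spectrum.mem_iff, Matrix.isUnit_iff_isUnit_det, isUnit_iff_ne_zero, not_not,
    ← Matrix.exists_mulVec_eq_zero_iff]
  refine exists_congr fun v => and_congr_right fun _ => ?_
  rw [Matrix.sub_mulVec, sub_eq_zero, Algebra.algebraMap_eq_smul_one, Matrix.smul_mulVec,
    Matrix.one_mulVec, eq_comm]

lemma map_ofReal_mulVec (A : Mat n n) (v : Fin n → ℂ) (i : Fin n) :
    (A.map Complex.ofReal *ᵥ v) i =
      ⟨(A *ᵥ fun j => (v j).re) i, (A *ᵥ fun j => (v j).im) i⟩ := by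
  apply Complex.ext
  · simp [Matrix.mulVec, dotProduct, Complex.re_sum]
  · simp [Matrix.mulVec, dotProduct, Complex.im_sum]

/-- Real form of the Hurwitz property: `a + i b` is an eigenvector for `α + i β`. -/
lemma isHurwitz_iff_real (A : Mat n n) :
    IsHurwitz A ↔ ∀ (α β : ℝ) (a b : Vec n), ¬(a = 0 ∧ b = 0) → act A a = α • a - β • b →
      act A b = β • a + α • b → α < 0 := by
  constructor
  · intro h α β a b hab ha hb
    refine h ⟨α, β⟩ ((mem_spectrum_iff_exists_mulVec _ _).2 ⟨fun i => ⟨a i, b i⟩, ?_, ?_⟩)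
    · intro h0
      apply hab
      constructor <;> ext i
      · exact congrArg Complex.re (congrFun h0 i)
      · exact congrArg Complex.im (congrFun h0 i)
    · ext1 i
      rw [map_ofReal_mulVec]
      have h1 := congrArg (fun v : Vec n => v i) ha
      have h2 := congrArg (fun v : Vec n => v i) hb
      simp at h1 h2
      apply Complex.ext
      · simpa using h1
      · simpa [add_comm] using h2
  · intro h z hz
    obtain ⟨v, hv, hAv⟩ := (mem_spectrum_iff_exists_mulVec _ _).1 hz
    refine h z.re z.im (WithLp.toLp 2 fun i => (v i).re) (WithLp.toLp 2 fun i => (v i).im) ?_ ?_ ?_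
    · rintro ⟨h1, h2⟩
      apply hv
      ext i
      apply Complex.ext
      · simpa using congrArg (fun v : Vec n => v i) h1
      · simpa using congrArg (fun v : Vec n => v i) h2
    · ext i
      have := congrArg Complex.re (congrFun hAv i)
      rw [map_ofReal_mulVec] at this
      simpa using this
    · ext i
      have := congrArg Complex.im (congrFun hAv i)
      rw [map_ofReal_mulVec] at this
      simpa [add_comm] using this

lemma IsHurwitz.transpose {A : Mat n n} (hA : IsHurwitz A) : IsHurwitz Aᵀ := by
  intro z hz
  refine hA z ?_
  rw [spectrum.mem_iff, Matrix.isUnit_iff_isUnit_det] at hz ⊢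
  rwa [← Matrix.det_transpose, Matrix.transpose_sub, Matrix.transpose_map,
    Algebra.algebraMap_eq_smul_one, Matrix.transpose_smul, Matrix.transpose_one,
    Matrix.transpose_transpose, ← Algebra.algebraMap_eq_smul_one] at hz

/-- A positive semidefinite solution of a detectable algebraic Riccati equation is stabilizing. -/
lemma isHurwitz_of_riccati {F P S : Mat n n} {C : Mat p n} (hdet : IsDetectable F C)
    (hP : P.PosSemidef) (hS : S.PosSemidef)
    (h : Fᵀ * P + P * F - P * S * P + Cᵀ * C = 0) : IsHurwitz (F - S * P) := by
  obtain ⟨L, hL⟩ := hdet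
  rw [isHurwitz_iff_real] at hL ⊢
  intro α β a b hab ha hb
  by_contra hα
  push Not at hα
  have hPt := transpose_eq_of_posSemidef hP
  -- The Riccati equation as a quadratic form: along `F - S P` the form of `P` decreases by exactly
  -- the `S` and `C` terms.
  have key : ∀ x : Vec n, 2 * inner ℝ (act P x) (act (F - S * P) x) =
      -inner ℝ (act P x) (act S (act P x)) - ‖act C x‖ ^ 2 := by
    intro x
    have h1 := congrArg (fun M : Mat n n => inner ℝ x (act M x)) h
    simp only [act_add_left, act_sub_left, act_mul, act_zero_left, inner_add_right,
      inner_sub_right, inner_zero_right] at h1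
    have hin : ∀ y : Vec n, inner ℝ x (act P y) = inner ℝ (act P x) y := fun y => by
      rw [inner_act_right, hPt]
    rw [← inner_act_left F, ← inner_act_left C, real_inner_self_eq_norm_sq, hin, hin,
      real_inner_comm] at h1
    rw [act_sub_left, inner_sub_right, act_mul]
    linarith
  -- The terms in `β` cancel because `P` is symmetric. With `α ≥ 0` this sum is nonnegative, while
  -- `key` makes it nonpositive, so every dissipated term vanishes.
  have hsum : inner ℝ (act P a) (act (F - S * P) a) + inner ℝ (act P b) (act (F - S * P) b) =
      α * (inner ℝ a (act P a) + inner ℝ b (act P b)) := by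
    have hsymm : inner ℝ (act P a) b = inner ℝ (act P b) a := by
      rw [inner_act_left, hPt, real_inner_comm]
    rw [ha, hb]
    simp only [inner_add_right, inner_sub_right, inner_smul_right]
    rw [hsymm, real_inner_comm (act P a) a, real_inner_comm (act P b) b]
    ring
  have p1 := inner_act_self_nonneg hP a
  have p2 := inner_act_self_nonneg hP b
  have s1 := inner_act_self_nonneg hS (act P a)
  have s2 := inner_act_self_nonneg hS (act P b)
  have h3 : 0 ≤ α * (inner ℝ a (act P a) + inner ℝ b (act P b)) := by positivity
  have k1 := key a
  have k2 := key b
  have c1 := sq_nonneg ‖act C a‖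
  have c2 := sq_nonneg ‖act C b‖
  have z1 : act S (act P a) = 0 := act_eq_zero_of_inner_eq_zero hS (by linarith)
  have z2 : act S (act P b) = 0 := act_eq_zero_of_inner_eq_zero hS (by linarith)
  have z3 : act C a = 0 := by
    rw [← norm_eq_zero, ← sq_eq_zero_iff]; linarith
  have z4 : act C b = 0 := by
    rw [← norm_eq_zero, ← sq_eq_zero_iff]; linarith
  -- On `a` and `b` both `S P` and `C` vanish, so `F - S P` and `F + L C` act alike there: the same
  -- eigenvector contradicts detectability.
  have := hL α β a b hab
    (by rw [← ha, act_add_left, act_sub_left, act_mul, act_mul, z1, z3]; simp)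
    (by rw [← hb, act_add_left, act_sub_left, act_mul, act_mul, z2, z4]; simp)
  linarith

/-- The Sylvester equation of two Hurwitz matrices has only the trivial solution. -/
lemma eq_zero_of_sylvester {H₁ H₂ T : Mat n n} (h₁ : IsHurwitz H₁) (h₂ : IsHurwitz H₂)
    (h : T * H₁ + H₂ᵀ * T = 0) : T = 0 := by
  set T' : Matrix (Fin n) (Fin n) ℂ := T.map Complex.ofReal with hT'
  set A : Matrix (Fin n) (Fin n) ℂ := H₁.map Complex.ofReal with hA
  set B : Matrix (Fin n) (Fin n) ℂ := -(H₂ᵀ.map Complex.ofReal) with hB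
  have hm : ∀ X Y : Mat n n, (X * Y).map Complex.ofReal =
      X.map Complex.ofReal * Y.map Complex.ofReal := fun X Y =>
    Matrix.map_mul (f := Complex.ofRealHom)
  have hTA : T' * A = B * T' := by
    have h1 : T * H₁ = -(H₂ᵀ * T) := eq_neg_of_add_eq_zero_left h
    have h2 := congrArg (fun X : Mat n n => X.map Complex.ofReal) h1
    simp only [hm] at h2
    rw [hT', hA, hB, h2, neg_mul, ← hm]
    ext i j
    simp
  have hpow : ∀ k : ℕ, T' * A ^ k = B ^ k * T' := by
    intro k
    induction k with
    | zero => simp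
    | succ k ih => rw [pow_succ, ← mul_assoc, ih, mul_assoc, hTA, ← mul_assoc, ← pow_succ]
  have hpoly : ∀ q : Polynomial ℂ, T' * Polynomial.aeval A q = Polynomial.aeval B q * T' := by
    intro q
    induction q using Polynomial.induction_on' with
    | add p q hp hq => simp [mul_add, add_mul, hp, hq]
    | monomial k c =>
      simp [Polynomial.aeval_monomial, Algebra.algebraMap_eq_smul_one, hpow]
  -- By Cayley–Hamilton the left side is zero. The matrix `χ_A(B)` is invertible, since the roots of
  -- `χ_A` lie in the left half-plane and the spectrum of `B` in the right one.
  have hchar := hpoly A.charpoly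
  rw [Matrix.aeval_self_charpoly, mul_zero] at hchar
  have hunit : IsUnit (Polynomial.aeval B A.charpoly) := by
    rcases Nat.eq_zero_or_pos n with rfl | hn
    · exact isUnit_of_subsingleton _
    have : Nonempty (Fin n) := ⟨⟨0, hn⟩⟩
    rw [← spectrum.zero_notMem_iff ℂ, spectrum.map_polynomial_aeval_of_nonempty]
    · rintro ⟨z, hz, hz0⟩
      have hzA : z ∈ spectrum ℂ A := by
        rw [Matrix.mem_spectrum_iff_isRoot_charpoly]
        exact hz0
      have hzB : -z ∈ spectrum ℂ (H₂ᵀ.map Complex.ofReal) := by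
        rw [hB, ← spectrum.neg_eq] at hz
        simpa using hz
      have i1 := h₁ z hzA
      have i2 := h₂.transpose _ hzB
      simp at i2
      linarith
    · exact spectrum.nonempty_of_isAlgClosed_of_finiteDimensional ℂ B
  have hT0 : T' = 0 := by
    have := hunit.mul_right_eq_zero.1 hchar.symm
    exact this
  ext i j
  have := congrFun (congrFun hT0 i) j
  simpa [hT'] using this

end Hurwitz

/-! ### Lyapunov functions by way of the Cayley transform. -/

section Lyapunov

variable {n : ℕ}

lemma IsHurwitz.isUnit_one_sub {H : Mat n n} (hH : IsHurwitz H) : IsUnit (1 - H) := by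
  rw [Matrix.isUnit_iff_isUnit_det, isUnit_iff_ne_zero]
  intro h0
  obtain ⟨v, hv, hv0⟩ := Matrix.exists_mulVec_eq_zero_iff.2 h0
  rw [Matrix.sub_mulVec, Matrix.one_mulVec, sub_eq_zero] at hv0
  have := (isHurwitz_iff_real H).1 hH 1 0 (WithLp.toLp 2 v) 0
    (fun h => hv (by simpa using h.1)) (by ext i; simp [← hv0]) (by simp)
  linarith

open scoped Matrix.Norms.L2Operator in
/-- A real matrix with all eigenvalues in the open unit disc has a contractive power. -/
lemma exists_pow_contracting {M : Mat n n}
    (hM : ∀ z ∈ spectrum ℂ (M.map Complex.ofReal), ‖z‖ < 1) :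
    ∃ k : ℕ, ∀ x : Vec n, ‖act (M ^ (k + 1)) x‖ ≤ 1 / 2 * ‖x‖ := by
  rcases Nat.eq_zero_or_pos n with rfl | hn
  · exact ⟨0, fun x => by rw [Subsingleton.elim x 0]; simp⟩
  have : Nonempty (Fin n) := ⟨⟨0, hn⟩⟩
  set A : Matrix (Fin n) (Fin n) ℂ := M.map Complex.ofReal with hA
  have hr : spectralRadius ℂ A < (1 : ℝ≥0) :=
    spectrum.spectralRadius_lt_of_forall_lt A fun z hz => by
      exact_mod_cast hM z hz
  obtain ⟨r, hr1, hr2⟩ := ENNReal.lt_iff_exists_nnreal_btwn.1 hr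
  -- Gelfand's formula, with `r` strictly between the spectral radius and 1.
  have hev : ∀ᶠ k : ℕ in atTop, ‖A ^ k‖₊ ≤ r ^ k := by
    filter_upwards [(spectrum.pow_nnnorm_pow_one_div_tendsto_nhds_spectralRadius A).eventually
      (gt_mem_nhds hr1), eventually_gt_atTop 0] with k hk hk0
    have h1 : ((‖A ^ k‖₊ : ℝ≥0∞) ^ (1 / k : ℝ)) ^ (k : ℝ) ≤ (r : ℝ≥0∞) ^ (k : ℝ) :=
      ENNReal.rpow_le_rpow hk.le (by positivity)
    rw [← ENNReal.rpow_mul, one_div_mul_cancel (by positivity), ENNReal.rpow_one,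
      ENNReal.rpow_natCast] at h1
    exact_mod_cast h1
  have hr3 : r < 1 := by exact_mod_cast hr2
  have hsmall : ∀ᶠ k : ℕ in atTop, r ^ k < 1 / 2 :=
    (NNReal.tendsto_pow_atTop_nhds_zero_of_lt_one hr3).eventually (gt_mem_nhds (by norm_num))
  obtain ⟨k, ⟨hk1, hk2⟩, hk0⟩ := ((hev.and hsmall).and (eventually_gt_atTop 0)).exists
  -- The exponent is kept positive so that the Lyapunov sum over smaller exponents contains the
  -- identity term.
  refine ⟨k - 1, fun x => ?_⟩
  rw [Nat.sub_add_cancel hk0]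
  have hpow : A ^ k = (M ^ k).map Complex.ofReal := by
    rw [hA]
    exact (Matrix.map_pow (f := Complex.ofRealHom) M k).symm
  have hk : ‖A ^ k‖ ≤ 1 / 2 := by
    have : ‖A ^ k‖₊ ≤ 1 / 2 := hk1.trans hk2.le
    exact_mod_cast this
  set xc : EuclideanSpace ℂ (Fin n) := WithLp.toLp 2 fun i => (x i : ℂ) with hxc
  have h1 : ‖xc‖ = ‖x‖ := by
    simp [hxc, EuclideanSpace.norm_eq]
  have h2 : ‖(WithLp.toLp 2 (A ^ k *ᵥ xc.ofLp) : EuclideanSpace ℂ (Fin n))‖ =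
      ‖act (M ^ k) x‖ := by
    rw [hpow]
    simp only [EuclideanSpace.norm_eq]
    congr 1
    refine Finset.sum_congr rfl fun i _ => ?_
    congr 1
    have : ((M ^ k).map Complex.ofReal *ᵥ xc.ofLp) i = ((act (M ^ k) x i : ℝ) : ℂ) := by
      rw [map_ofReal_mulVec]
      apply Complex.ext
      · rfl
      · simp only [hxc, Complex.ofReal_im]
        exact congrFun (Matrix.mulVec_zero (M ^ k)) i
    simp only [this, Complex.norm_real]
  rw [← h2, ← h1]
  exact (Matrix.l2_opNorm_mulVec (A ^ k) xc).trans (by gcongr)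

/-- An eigenvalue `z` of the Cayley transform comes from the eigenvalue `(z - 1)/(z + 1)` of `H`,
whose real part times `|z + 1|²` is `|z|² - 1`. This carries the half-plane to the disc, where
powers can be used in place of exponentials. -/
lemma IsHurwitz.norm_spectrum_cayley_lt_one {H : Mat n n} (hH : IsHurwitz H) {M : Mat n n}
    (hM : (1 - H) * M = 1 + H) : ∀ z ∈ spectrum ℂ (M.map Complex.ofReal), ‖z‖ < 1 := by
  intro z hz
  obtain ⟨v, hv, hvz⟩ := (mem_spectrum_iff_exists_mulVec _ _).1 hz
  set Hc : Matrix (Fin n) (Fin n) ℂ := H.map Complex.ofReal with hHc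
  have h1 : (1 - Hc) * M.map Complex.ofReal = 1 + Hc := by
    have := congrArg (fun X : Mat n n => X.map Complex.ofRealHom) hM
    simp only [Matrix.map_mul] at this
    have e1 : (1 - H).map Complex.ofRealHom = 1 - Hc := by
      rw [Matrix.map_sub _ (by simp)]; simp [hHc]; rfl
    have e2 : (1 + H).map Complex.ofRealHom = 1 + Hc := by
      rw [Matrix.map_add _ (by simp)]; simp [hHc]; rfl
    rwa [e1, e2] at this
  have h2 := congrArg (fun X : Matrix (Fin n) (Fin n) ℂ => X *ᵥ v) h1
  simp only [← Matrix.mulVec_mulVec, hvz, Matrix.add_mulVec, Matrix.sub_mulVec,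
    Matrix.one_mulVec, Matrix.mulVec_smul] at h2
  have h3 : (z + 1) • (Hc *ᵥ v) = (z - 1) • v := by
    have e : z • v - z • (Hc *ᵥ v) = v + Hc *ᵥ v := by simpa [smul_sub] using h2
    rw [add_smul, sub_smul, one_smul, one_smul]
    linear_combination (exp := 1) -e
  have hz1 : z + 1 ≠ 0 := by
    intro h0
    rw [h0, zero_smul, show z - 1 = (-2 : ℂ) by linear_combination h0, eq_comm,
      smul_eq_zero] at h3
    rcases h3 with h3 | h3
    · norm_num at h3
    · exact hv h3
  have h4 : Hc *ᵥ v = ((z - 1) / (z + 1)) • v := by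
    rw [div_eq_inv_mul, mul_smul, ← h3, smul_smul, inv_mul_cancel₀ hz1, one_smul]
  have h5 := hH _ ((mem_spectrum_iff_exists_mulVec _ _).2 ⟨v, hv, h4⟩)
  have hn : 0 < Complex.normSq (z + 1) := Complex.normSq_pos.2 hz1
  have h6 : ((z - 1) / (z + 1)).re * Complex.normSq (z + 1) = Complex.normSq z - 1 := by
    rw [Complex.div_re]
    field_simp
    simp [Complex.normSq_apply]
    ring
  have h7 : Complex.normSq z < 1 := by nlinarith
  rw [Complex.normSq_eq_norm_sq] at h7
  nlinarith [norm_nonneg z]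

/-- Lyapunov's theorem. -/
lemma IsHurwitz.exists_lyapunov {H : Mat n n} (hH : IsHurwitz H) :
    ∃ X : Mat n n, Xᵀ = X ∧ (∀ x : Vec n, ‖x‖ ^ 2 ≤ inner ℝ (act X x) x) ∧
      ∃ c > 0, ∀ x : Vec n, inner ℝ (act X x) (act H x) ≤ -(c * ‖x‖ ^ 2) := by
  have hu := hH.isUnit_one_sub
  have hdet : IsUnit (1 - H).det := (Matrix.isUnit_iff_isUnit_det _).1 hu
  set U : Mat n n := (1 - H)⁻¹ with hU
  have hU1 : (1 - H) * U = 1 := Matrix.mul_nonsing_inv _ hdet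
  have hU2 : U * (1 - H) = 1 := Matrix.nonsing_inv_mul _ hdet
  set M : Mat n n := U * (1 + H) with hMdef
  have hM1 : (1 - H) * M = 1 + H := by rw [hMdef, ← mul_assoc, hU1, one_mul]
  have hM2 : M * (1 - H) = 1 + H := by
    have : (1 + H) * (1 - H) = (1 - H) * (1 + H) := by noncomm_ring
    rw [hMdef, mul_assoc, this, ← mul_assoc, hU2, one_mul]
  obtain ⟨k, hk⟩ := exists_pow_contracting (hH.norm_spectrum_cayley_lt_one hM1)
  -- A truncated discrete Lyapunov series. In the variable `w = (1 - H) x` one has `x = (w + M w)/2`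
  -- and `H x = (M w - w)/2`, so the form telescopes to `(‖M^(k+1) w‖² - ‖w‖²)/4`.
  set X : Mat n n := ∑ j ∈ Finset.range (k + 1), (M ^ j)ᵀ * M ^ j with hX
  have hXin : ∀ x y : Vec n, inner ℝ (act X x) y =
      ∑ j ∈ Finset.range (k + 1), inner ℝ (act (M ^ j) x) (act (M ^ j) y) := by
    intro x y
    have : act X x = ∑ j ∈ Finset.range (k + 1), act ((M ^ j)ᵀ * M ^ j) x := by
      simp [hX, act]
    rw [this, sum_inner]
    refine Finset.sum_congr rfl fun j _ => ?_
    rw [act_mul, inner_act_left, Matrix.transpose_transpose]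
  -- `3/16` is `(1 - 1/4)/4`, from the contraction by 1/2; the other factor converts `‖w‖` to `‖x‖`
  -- through `x = U w`, with `+ 1` keeping the denominator positive.
  refine ⟨X, ?_, ?_, 3 / 16 / (‖actCLM U‖ ^ 2 + 1), by positivity, ?_⟩
  · simp [hX, Matrix.transpose_sum]
  · intro x
    rw [hXin, Finset.sum_range_succ', pow_zero, act_one, real_inner_self_eq_norm_sq]
    simp only [real_inner_self_eq_norm_sq]
    have : 0 ≤ ∑ j ∈ Finset.range k, ‖act (M ^ (j + 1)) x‖ ^ 2 := by positivity
    linarith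
  · intro x
    set w := act (1 - H) x with hw
    have hw1 : w = x - act H x := by rw [hw, act_sub_left, act_one]
    have hw2 : act M w = x + act H x := by rw [hw, ← act_mul, hM2, act_add_left, act_one]
    have hx1 : x = (1 / 2 : ℝ) • (w + act M w) := by rw [hw2, hw1]; module
    have hx2 : act H x = (1 / 2 : ℝ) • (act M w - w) := by rw [hw2, hw1]; module
    have hxn : ‖x‖ ≤ ‖actCLM U‖ * ‖w‖ := by
      have : x = act U w := by rw [hw, ← act_mul, hU2, act_one]
      conv_lhs => rw [this]
      exact norm_act_le U w
    have hstep : inner ℝ (act X x) (act H x) =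
        1 / 4 * ∑ j ∈ Finset.range (k + 1),
          (‖act (M ^ (j + 1)) w‖ ^ 2 - ‖act (M ^ j) w‖ ^ 2) := by
      rw [hXin, Finset.mul_sum]
      refine Finset.sum_congr rfl fun j _ => ?_
      rw [hx2, hx1]
      simp only [map_smul, map_add, map_sub, inner_smul_left, inner_smul_right, inner_add_left,
        inner_sub_right, pow_succ, act_mul, real_inner_self_eq_norm_sq]
      rw [real_inner_comm (act (M ^ j) w)]
      simp only [conj_trivial]
      ring
    rw [hstep, Finset.sum_range_sub (fun j => ‖act (M ^ j) w‖ ^ 2), pow_zero, act_one]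
    have h1 : ‖act (M ^ (k + 1)) w‖ ^ 2 ≤ (1 / 2 * ‖w‖) ^ 2 := by
      gcongr
      exact hk w
    have h2 : ‖x‖ ^ 2 ≤ ‖actCLM U‖ ^ 2 * ‖w‖ ^ 2 := by
      rw [← mul_pow]; gcongr
    have h3 : 3 / 16 / (‖actCLM U‖ ^ 2 + 1) * ‖x‖ ^ 2 ≤ 3 / 16 * ‖w‖ ^ 2 := by
      rw [div_mul_eq_mul_div, div_le_iff₀ (by positivity)]
      nlinarith [sq_nonneg ‖w‖]
    linarith

end Lyapunov

/-! ### Monotone functions on the half-line. -/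

section HalfLine

lemma monotoneOn_Ici_of_hasDerivWithinAt {V V' : ℝ → ℝ}
    (h : ∀ t ∈ Ici (0 : ℝ), HasDerivWithinAt V (V' t) (Ici 0) t)
    (h' : ∀ t ∈ Ici (0 : ℝ), 0 ≤ V' t) : MonotoneOn V (Ici 0) := by
  refine monotoneOn_of_hasDerivWithinAt_nonneg (f' := V') (convex_Ici 0)
    (fun t ht => (h t ht).continuousWithinAt) (fun t ht => ?_) fun t ht => ?_
  · exact (h t (interior_subset ht)).mono interior_subset
  · exact h' t (interior_subset ht)

/-- A positive value would be a lower bound from that time on, contradicting integrability. This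
replaces a transversality condition: membership in `C_{ρ/2}` gives integrability of quadratic forms,
not decay at infinity. -/
lemma nonpos_of_monotoneOn_of_integrableOn {V : ℝ → ℝ} (hV : MonotoneOn V (Ici 0))
    (hi : IntegrableOn V (Ici 0)) {t : ℝ} (ht : 0 ≤ t) : V t ≤ 0 := by
  by_contra! hpos
  have h1 : IntegrableOn V (Ici t) := hi.mono_set (Ici_subset_Ici.2 ht)
  have h2 : IntegrableOn (fun _ => V t) (Ici t) := by
    refine Integrable.mono' h1 aestronglyMeasurable_const ?_
    filter_upwards [ae_restrict_mem measurableSet_Ici] with u hu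
    rw [Real.norm_of_nonneg hpos.le]
    exact hV ht (ht.trans hu) hu
  rw [integrableOn_const_iff] at h2
  rcases h2 with h2 | h2
  · exact hpos.ne' (by simpa using h2)
  · simp at h2

end HalfLine

/-! ### Stability properties of `C_{ρ/2}`. -/

section InCrho

variable {n m : ℕ} {ρ : ℝ} {g h : ℝ → Vec n}

lemma InCrho.integrableOn_inner (hg : InCrho ρ g) (hh : InCrho ρ h) :
    IntegrableOn (fun t => Real.exp (-ρ * t) * inner ℝ (g t) (h t)) (Ici 0) := by
  refine Integrable.mono' (hg.2.add hh.2) ?_ ?_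
  · refine ContinuousOn.aestronglyMeasurable ?_ measurableSet_Ici
    exact (by fun_prop : Continuous fun t => Real.exp (-ρ * t)).continuousOn.mul
      (hg.1.inner hh.1)
  · refine ae_of_all _ fun t => ?_
    have h1 := abs_real_inner_le_norm (g t) (h t)
    rw [norm_mul, Real.norm_of_nonneg (Real.exp_nonneg _), Real.norm_eq_abs]
    simp only [Pi.add_apply]
    rw [← mul_add]
    gcongr
    nlinarith [sq_nonneg (‖g t‖ - ‖h t‖), norm_nonneg (g t), norm_nonneg (h t)]

lemma InCrho.comp_actCLM (hg : InCrho ρ g) (A : Mat m n) : InCrho ρ fun t => act A (g t) := by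
  have hc : ContinuousOn (fun t => act A (g t)) (Ici 0) := (continuous_act A).comp_continuousOn hg.1
  refine ⟨hc, Integrable.mono' (hg.2.const_mul (‖actCLM A‖ ^ 2)) ?_ ?_⟩
  · refine ContinuousOn.aestronglyMeasurable ?_ measurableSet_Ici
    exact (by fun_prop : Continuous fun t => Real.exp (-ρ * t)).continuousOn.mul (hc.norm.pow 2)
  · refine ae_of_all _ fun t => ?_
    rw [Real.norm_of_nonneg (by positivity), mul_left_comm, ← mul_pow]
    gcongr
    exact norm_act_le A (g t)

lemma InCrho.add (hg : InCrho ρ g) (hh : InCrho ρ h) : InCrho ρ fun t => g t + h t := by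
  refine ⟨hg.1.add hh.1, ((hg.2.add hh.2).add ((hg.integrableOn_inner hh).const_mul 2)).congr
    (ae_of_all _ fun t => ?_)⟩
  simp only [Pi.add_apply, norm_add_sq_real]
  ring

lemma InCrho.neg (hg : InCrho ρ g) : InCrho ρ fun t => -g t :=
  ⟨hg.1.neg, by simpa using hg.2⟩

lemma InCrho.sub (hg : InCrho ρ g) (hh : InCrho ρ h) : InCrho ρ fun t => g t - h t := by
  simpa [sub_eq_add_neg] using hg.add hh.neg

end InCrho

/-! ### Deterministic uniqueness: adjoint equation and Hamiltonian system. -/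

section Deterministic

variable {n r : ℕ}

lemma hasDerivWithinAt_act {n m : ℕ} (A : Mat m n) {g : ℝ → Vec n} {g' : Vec n} {s : Set ℝ} {t : ℝ}
    (hg : HasDerivWithinAt g g' s t) : HasDerivWithinAt (fun t => act A (g t)) (act A g') s t :=
  (actCLM A).hasFDerivAt.comp_hasDerivWithinAt t hg

lemma hasDerivWithinAt_exp_mul {ρ : ℝ} {g : ℝ → ℝ} {g' : ℝ} {s : Set ℝ} {t : ℝ}
    (hg : HasDerivWithinAt g g' s t) :
    HasDerivWithinAt (fun t => Real.exp (-ρ * t) * g t) (Real.exp (-ρ * t) * (g' - ρ * g t)) s t := by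
  have h1 : HasDerivWithinAt (fun t : ℝ => Real.exp (-ρ * t)) (Real.exp (-ρ * t) * (-ρ * 1)) s t :=
    (((hasDerivAt_id t).const_mul (-ρ)).exp).hasDerivWithinAt
  refine (h1.mul hg).congr_deriv ?_
  ring

/-- The anti-stable adjoint equation has no nonzero solution in `C_{ρ/2}`. -/
lemma eqOn_zero_of_adjoint {ρ : ℝ} {F : Mat n n} (hF : IsHurwitz (F - (ρ / 2) • (1 : Mat n n)))
    {d : ℝ → Vec n} (hd : InCrho ρ d)
    (hode : ∀ t ∈ Ici (0 : ℝ), HasDerivWithinAt d (ρ • d t - act Fᵀ (d t)) (Ici 0) t) :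
    ∀ t ∈ Ici (0 : ℝ), d t = 0 := by
  obtain ⟨X, hXt, hX1, c, hc, hX2⟩ := hF.transpose.exists_lyapunov
  -- Discounting the quadratic form replaces `F` by `F - ρ/2`; a Lyapunov matrix of the transpose
  -- then makes the form nondecreasing.
  have hV : ∀ t ∈ Ici (0 : ℝ), HasDerivWithinAt
      (fun t => Real.exp (-ρ * t) * inner ℝ (act X (d t)) (d t))
      (Real.exp (-ρ * t) * (-2 * inner ℝ (act X (d t))
        (act (F - (ρ / 2) • (1 : Mat n n))ᵀ (d t)))) (Ici 0) t := by
    intro t ht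
    refine (hasDerivWithinAt_exp_mul
      ((hasDerivWithinAt_act X (hode t ht)).inner ℝ (hode t ht))).congr_deriv ?_
    congr 1
    rw [inner_act_left X (_ - _), hXt, real_inner_comm (act X (d t)) (_ - _)]
    simp only [Matrix.transpose_sub, Matrix.transpose_smul, Matrix.transpose_one, act_sub_left,
      act_smul_left, act_one, inner_sub_right, inner_smul_right]
    ring
  have hmono := monotoneOn_Ici_of_hasDerivWithinAt hV fun t _ => by
    have := hX2 (d t)
    have : 0 ≤ c * ‖d t‖ ^ 2 := by positivity
    exact mul_nonneg (Real.exp_nonneg _) (by linarith)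
  intro t ht
  have h1 := nonpos_of_monotoneOn_of_integrableOn hmono
    ((hd.comp_actCLM X).integrableOn_inner hd) ht
  have h2 : inner ℝ (act X (d t)) (d t) ≤ 0 := nonpos_of_mul_nonpos_right h1 (Real.exp_pos _)
  have h3 := hX1 (d t)
  rw [← norm_eq_zero, ← sq_eq_zero_iff]
  linarith [sq_nonneg ‖d t‖]

lemma eqOn_zero_of_linear_ode {A : Mat n n} {y : ℝ → Vec n} (h0 : y 0 = 0)
    (hode : ∀ t ∈ Ici (0 : ℝ), HasDerivWithinAt y (act A (y t)) (Ici 0) t) :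
    ∀ t ∈ Ici (0 : ℝ), y t = 0 := by
  intro t ht
  have := ODE_solution_unique_of_mem_Icc_right (v := fun _ x => act A x) (s := fun _ => univ)
    (K := ‖actCLM A‖₊) (f := y) (g := fun _ => 0) (a := 0) (b := t)
    (fun _ _ => (actCLM A).lipschitz.lipschitzOnWith)
    (fun u hu => (hode u hu.1).continuousWithinAt.mono Icc_subset_Ici_self)
    (fun u hu => (hode u hu.1).mono (Ici_subset_Ici.2 hu.1)) (fun _ _ => mem_univ _)
    continuousOn_const
    (fun u _ => by simpa using hasDerivWithinAt_const u (Ici u) (0 : Vec n))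
    (fun _ _ => mem_univ _) h0
  exact this ⟨ht, le_rfl⟩

/-- Two solutions in `C_{ρ/2}` of the Hamiltonian system with the same initial state have the same
state, and their costates agree modulo the kernel of `S`. -/
lemma hamiltonian_unique {ρ : ℝ} {A S Q : Mat n n} {η : Vec n} (hS : S.PosSemidef)
    (hQ : Q.PosSemidef) {x₁ x₂ ν₁ ν₂ : ℝ → Vec n} (h0 : x₁ 0 = x₂ 0)
    (hx₁ : InCrho ρ x₁) (hx₂ : InCrho ρ x₂) (hν₁ : InCrho ρ ν₁) (hν₂ : InCrho ρ ν₂)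
    (ex₁ : ∀ t ∈ Ici (0 : ℝ), HasDerivWithinAt x₁ (act A (x₁ t) - act S (ν₁ t)) (Ici 0) t)
    (ex₂ : ∀ t ∈ Ici (0 : ℝ), HasDerivWithinAt x₂ (act A (x₂ t) - act S (ν₂ t)) (Ici 0) t)
    (eν₁ : ∀ t ∈ Ici (0 : ℝ), HasDerivWithinAt ν₁
      (ρ • ν₁ t - act Aᵀ (ν₁ t) - act Q (x₁ t) + η) (Ici 0) t)
    (eν₂ : ∀ t ∈ Ici (0 : ℝ), HasDerivWithinAt ν₂
      (ρ • ν₂ t - act Aᵀ (ν₂ t) - act Q (x₂ t) + η) (Ici 0) t) :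
    ∀ t ∈ Ici (0 : ℝ), x₁ t = x₂ t ∧ inner ℝ (ν₁ t - ν₂ t) (act S (ν₁ t - ν₂ t)) = 0 := by
  set y := fun t => x₁ t - x₂ t with hy
  set l := fun t => ν₁ t - ν₂ t with hl
  have ey : ∀ t ∈ Ici (0 : ℝ), HasDerivWithinAt y (act A (y t) - act S (l t)) (Ici 0) t := by
    intro t ht
    refine ((ex₁ t ht).sub (ex₂ t ht)).congr_deriv ?_
    simp only [hy, hl, map_sub]
    abel
  have el : ∀ t ∈ Ici (0 : ℝ), HasDerivWithinAt l
      (ρ • l t - act Aᵀ (l t) - act Q (y t)) (Ici 0) t := by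
    intro t ht
    refine ((eν₁ t ht).sub (eν₂ t ht)).congr_deriv ?_
    simp only [hy, hl, map_sub, smul_sub]
    abel
  -- In the derivative the `A` terms cancel by adjointness and the `ρ` term cancels the discount,
  -- leaving two nonnegative forms.
  set V := fun t => -(Real.exp (-ρ * t) * inner ℝ (y t) (l t)) with hV
  have eV : ∀ t ∈ Ici (0 : ℝ), HasDerivWithinAt V (Real.exp (-ρ * t) *
      (inner ℝ (l t) (act S (l t)) + inner ℝ (y t) (act Q (y t)))) (Ici 0) t := by
    intro t ht
    refine (hasDerivWithinAt_exp_mul ((ey t ht).inner ℝ (el t ht))).neg.congr_deriv ?_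
    simp only [inner_sub_left, inner_sub_right, inner_smul_right, inner_act_left A]
    rw [real_inner_comm (l t) (act S (l t))]
    ring
  have hS' := fun t => inner_act_self_nonneg hS (l t)
  have hQ' := fun t => inner_act_self_nonneg hQ (y t)
  have hmono := monotoneOn_Ici_of_hasDerivWithinAt eV fun t _ =>
    mul_nonneg (Real.exp_nonneg _) (add_nonneg (hS' t) (hQ' t))
  have hint : IntegrableOn V (Ici 0) :=
    ((hx₁.sub hx₂).integrableOn_inner (hν₁.sub hν₂)).neg
  have hV0 : V 0 = 0 := by simp [hV, hy, h0]
  have hVz : ∀ t ∈ Ici (0 : ℝ), V t = 0 := fun t ht =>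
    le_antisymm (nonpos_of_monotoneOn_of_integrableOn hmono hint ht)
      (hV0 ▸ hmono self_mem_Ici ht ht)
  have hz : ∀ t ∈ Ici (0 : ℝ), inner ℝ (l t) (act S (l t)) = 0 := by
    intro t ht
    have h1 : HasDerivWithinAt V 0 (Ici 0) t :=
      (hasDerivWithinAt_const t (Ici (0 : ℝ)) (0 : ℝ)).congr hVz (hVz t ht)
    have h2 := (uniqueDiffOn_Ici (0 : ℝ) t ht).eq_deriv _ (eV t ht) h1
    rcases mul_eq_zero.1 h2 with h2 | h2
    · exact absurd h2 (Real.exp_pos _).ne'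
    · linarith [hS' t, hQ' t]
  -- Once `S l = 0`, the state difference obeys `y' = A y` with zero initial value.
  have hy0 := eqOn_zero_of_linear_ode (A := A) (y := y) (by simp [hy, h0]) fun t ht =>
    (ey t ht).congr_deriv (by rw [act_eq_zero_of_inner_eq_zero hS (hz t ht), sub_zero])
  exact fun t ht => ⟨sub_eq_zero.1 (hy0 t ht), hz t ht⟩

namespace Model

variable (M : Model n r)

lemma posSemidef_S (hR : M.R.PosDef) : M.S.PosSemidef := by
  have := hR.inv.posSemidef.mul_mul_conjTranspose_same M.B
  rwa [Matrix.conjTranspose_eq_transpose_of_trivial] at this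

lemma posSemidef_Qhat (hQ : M.Q.PosSemidef) : M.Qhat.PosSemidef := by
  have := hQ.conjTranspose_mul_mul_same (1 - M.Γ)
  rwa [Matrix.conjTranspose_eq_transpose_of_trivial] at this

lemma Qhat_eq : M.Qhat = M.Q - M.QΓ := by
  simp only [Qhat, QΓ, Matrix.transpose_sub, Matrix.transpose_one]
  noncomm_ring

/-- `⟨l, S l⟩` is the form of the positive semidefinite matrix `R⁻¹` at `Bᵀ l`. Hence the ambiguity
that remains in the costate is invisible to the control. -/
lemma gain_eq_zero (hR : M.R.PosDef) {l : Vec n} (h : inner ℝ l (act M.S l) = 0) :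
    act (M.R⁻¹ * M.Bᵀ) l = 0 := by
  have h1 : act M.S l = act M.B (act M.R⁻¹ (act M.Bᵀ l)) := by rw [S, act_mul, act_mul]
  rw [h1, inner_act_right M.B] at h
  rw [act_mul]
  exact act_eq_zero_of_inner_eq_zero hR.inv.posSemidef h

/-- `Y = P + K̄` solves the second Riccati equation when `K̄` is symmetric. -/
lemma riccati_add {P K : Mat n n} (hP : M.RiccatiP P) (hPt : Pᵀ = P) (hKt : Kᵀ = K)
    (hSt : M.Sᵀ = M.S)
    (hK : M.ρ • K = K * M.Abar P + (M.Abar P)ᵀ * K - K * M.S * Kᵀ - M.QΓ) :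
    M.ρ • (P + K) = M.Aᵀ * (P + K) + (P + K) * M.A - (P + K) * M.S * (P + K) + M.Qhat := by
  rw [smul_add, hK, hP, Qhat_eq, Abar, Matrix.transpose_sub, Matrix.transpose_mul, hPt, hKt, hSt]
  noncomm_ring

/-- The Riccati equation for `P + K` cancels the terms quadratic in this matrix, so state and
costate obey a Hamiltonian system with coefficients independent of `P` and `K`. Different solutions
`K` thus become comparable. -/
lemma costate {xbar0 : Vec n} {P K : Mat n n} {x φ : ℝ → Vec n} (hP : M.RiccatiP P)
    (hPt : Pᵀ = P) (hKt : Kᵀ = K) (hSt : M.Sᵀ = M.S) (h : M.SolvesHCM xbar0 P K x φ) :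
    InCrho M.ρ (fun t => act (P + K) (x t) + φ t) ∧
    (∀ t ∈ Ici (0 : ℝ), HasDerivWithinAt x
      (act M.A (x t) - act M.S (act (P + K) (x t) + φ t)) (Ici 0) t) ∧
    (∀ t ∈ Ici (0 : ℝ), HasDerivWithinAt (fun t => act (P + K) (x t) + φ t)
      (M.ρ • (act (P + K) (x t) + φ t) - act M.Aᵀ (act (P + K) (x t) + φ t)
        - act M.Qhat (x t) + M.ηbar) (Ici 0) t) := by
  obtain ⟨hK, hx, hφ, -, ex, eφ⟩ := h
  have hY := M.riccati_add hP hPt hKt hSt hK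
  have ex' : ∀ t ∈ Ici (0 : ℝ), HasDerivWithinAt x
      (act M.A (x t) - act M.S (act (P + K) (x t) + φ t)) (Ici 0) t := by
    intro t ht
    refine (ex t ht).congr_deriv ?_
    simp only [Abar, act_sub_left, act_mul, act_add_left, map_add]
    abel
  refine ⟨(hx.comp_actCLM _).add hφ, ex', fun t ht => ?_⟩
  refine ((hasDerivWithinAt_act (P + K) (ex' t ht)).add (eφ t ht)).congr_deriv ?_
  have hYx := congrArg (fun Z : Mat n n => act Z (x t)) hY
  have hYt : (P + K)ᵀ = P + K := by rw [Matrix.transpose_add, hPt, hKt]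
  generalize P + K = Y at *
  simp only [act_add_left, act_sub_left, act_smul_left, act_mul] at hYx
  have hQx : act M.Qhat (x t) = M.ρ • act Y (x t) - act M.Aᵀ (act Y (x t)) - act Y (act M.A (x t))
      + act Y (act M.S (act Y (x t))) := by
    rw [hYx]; abel
  rw [hQx]
  simp only [Matrix.transpose_sub, Matrix.transpose_mul, hYt, hSt, Matrix.transpose_smul,
    Matrix.transpose_one, act_sub_left, act_smul_left, act_mul, act_one, map_add, map_sub, smul_add]
  abel

end Model

end Deterministic

/-! ### Stabilizing Riccati solutions and comparison of the two systems. -/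

variable {n r : ℕ}

open scoped MatrixOrder in
lemma sqrtMat_transpose_mul_self {Q : Mat n n} (hQ : Q.PosSemidef) :
    (sqrtMat Q)ᵀ * sqrtMat Q = Q := by
  have h1 : (sqrtMat Q).PosSemidef := Matrix.nonneg_iff_posSemidef.1 (CFC.sqrt_nonneg Q)
  rw [transpose_eq_of_posSemidef h1]
  exact CFC.sqrt_mul_sqrt_self Q hQ.nonneg

namespace Model

variable (M : Model n r)

/-- Splitting `ρ P` into two halves absorbs the discount into the shift `A - ρ/2`, giving the
undiscounted form required by `isHurwitz_of_riccati`. -/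
lemma shifted_riccati {P C : Mat n n}
    (h : M.ρ • P = M.Aᵀ * P + P * M.A - P * M.S * P + Cᵀ * C) :
    (M.A - (M.ρ / 2) • (1 : Mat n n))ᵀ * P + P * (M.A - (M.ρ / 2) • (1 : Mat n n))
      - P * M.S * P + Cᵀ * C = 0 := by
  have h1 : (M.ρ / 2) • P + (M.ρ / 2) • P = M.ρ • P := by rw [← add_smul, add_halves]
  simp only [Matrix.transpose_sub, Matrix.transpose_smul, Matrix.transpose_one, sub_mul, mul_sub,
    smul_mul_assoc, one_mul, mul_smul_comm, mul_one]
  rw [← sub_eq_zero, h1.symm] at h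
  rw [← neg_eq_zero, ← h]
  abel

lemma isHurwitz_Abar (hR : M.R.PosDef) (hQ : M.Q.PosSemidef)
    (hdet : IsDetectable (M.A - (M.ρ / 2) • (1 : Mat n n)) (sqrtMat M.Q))
    {P : Mat n n} (hPpos : P.PosSemidef) (hP : M.RiccatiP P) :
    IsHurwitz (M.Abar P - (M.ρ / 2) • (1 : Mat n n)) := by
  have h := isHurwitz_of_riccati hdet hPpos (M.posSemidef_S hR)
    (M.shifted_riccati (by rw [sqrtMat_transpose_mul_self hQ]; exact hP))
  rwa [sub_right_comm] at h

/-- Here `Q̂ = CᵀC` with `C = √Q (I - Γ)`, which is why detectability is required of this output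
matrix. -/
lemma isHurwitz_closedLoop (hR : M.R.PosDef) (hQ : M.Q.PosSemidef)
    (hdet : IsDetectable (M.A - (M.ρ / 2) • (1 : Mat n n)) (sqrtMat M.Q * (1 - M.Γ)))
    {Y : Mat n n} (hYpos : Y.PosSemidef)
    (hY : M.ρ • Y = M.Aᵀ * Y + Y * M.A - Y * M.S * Y + M.Qhat) :
    IsHurwitz (M.A - M.S * Y - (M.ρ / 2) • (1 : Mat n n)) := by
  have h := isHurwitz_of_riccati hdet hYpos (M.posSemidef_S hR)
    (M.shifted_riccati (by
      rw [hY, Matrix.transpose_mul, Matrix.mul_assoc (1 - M.Γ)ᵀ, ← Matrix.mul_assoc _ (sqrtMat M.Q),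
        sqrtMat_transpose_mul_self hQ, Qhat, Matrix.mul_assoc (1 - M.Γ)ᵀ]))
  rwa [sub_right_comm] at h

/-- The term `K S Kᵀ` is symmetric whatever `K` is, so it cancels from the difference of the
equation and its transpose. What remains is a homogeneous Sylvester equation for `Kᵀ - K`. -/
lemma transpose_eq_of_solvesHCM (hSt : M.Sᵀ = M.S) {P K : Mat n n}
    (hH : IsHurwitz (M.Abar P - (M.ρ / 2) • (1 : Mat n n))) (hQ : M.Qᵀ = M.Q)
    (hK : M.ρ • K = K * M.Abar P + (M.Abar P)ᵀ * K - K * M.S * Kᵀ - M.QΓ) : Kᵀ = K := by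
  have hKt := congrArg Matrix.transpose hK
  have hQΓ : M.QΓᵀ = M.QΓ := by
    simp only [QΓ, Matrix.transpose_sub, Matrix.transpose_add, Matrix.transpose_mul,
      Matrix.transpose_transpose, hQ]
    noncomm_ring
  simp only [Matrix.transpose_sub, Matrix.transpose_add, Matrix.transpose_mul,
    Matrix.transpose_transpose, Matrix.transpose_smul, hQΓ, hSt] at hKt
  rw [← sub_eq_zero]
  refine eq_zero_of_sylvester hH hH ?_
  have h1 : (M.ρ / 2) • (Kᵀ - K) + (M.ρ / 2) • (Kᵀ - K) = M.ρ • Kᵀ - M.ρ • K := by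
    rw [← add_smul, add_halves, smul_sub]
  rw [hKt, hK] at h1
  simp only [Matrix.transpose_sub, Matrix.transpose_smul, Matrix.transpose_one, sub_mul, mul_sub,
    smul_mul_assoc, one_mul, mul_smul_comm, mul_one, smul_sub, ← Matrix.mul_assoc] at h1 ⊢
  rw [← sub_eq_zero] at h1
  rw [← neg_eq_zero, ← h1]
  abel

/-- The difference `D` satisfies `D (A - S Y₂) + (A - S Y₁)ᵀ D = ρ D`: using one closed-loop matrix
on each side cancels the mixed terms `Y₁ S Y₂`, and halving `ρ` leaves a Sylvester equation of
Hurwitz matrices. -/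
lemma riccati_unique {Y₁ Y₂ : Mat n n} (h₁t : Y₁ᵀ = Y₁) (hSt : M.Sᵀ = M.S)
    (h₁ : M.ρ • Y₁ = M.Aᵀ * Y₁ + Y₁ * M.A - Y₁ * M.S * Y₁ + M.Qhat)
    (h₂ : M.ρ • Y₂ = M.Aᵀ * Y₂ + Y₂ * M.A - Y₂ * M.S * Y₂ + M.Qhat)
    (hH₁ : IsHurwitz (M.A - M.S * Y₁ - (M.ρ / 2) • (1 : Mat n n)))
    (hH₂ : IsHurwitz (M.A - M.S * Y₂ - (M.ρ / 2) • (1 : Mat n n))) : Y₁ = Y₂ := by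
  rw [← sub_eq_zero]
  refine eq_zero_of_sylvester hH₂ hH₁ ?_
  have h3 : (M.ρ / 2) • (Y₁ - Y₂) + (M.ρ / 2) • (Y₁ - Y₂) = M.ρ • Y₁ - M.ρ • Y₂ := by
    rw [← add_smul, add_halves, smul_sub]
  rw [h₁, h₂] at h3
  simp only [Matrix.transpose_sub, Matrix.transpose_smul, Matrix.transpose_one,
    Matrix.transpose_mul, h₁t, hSt, sub_mul, mul_sub, smul_mul_assoc, one_mul, mul_smul_comm,
    mul_one, smul_sub, ← Matrix.mul_assoc] at h3 ⊢
  rw [← sub_eq_zero] at h3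
  rw [← neg_eq_zero, ← h3]
  abel

lemma solvesHCM_of_solvesMeanField (hG : M.G = 0) (hf : M.f = 0) {xbar0 : Vec n} {P Y : Mat n n}
    (hPt : Pᵀ = P) (hYt : Yᵀ = Y) (hSt : M.Sᵀ = M.S) (hP : M.RiccatiP P) (hY : M.RiccatiPi Y)
    {s xbar : ℝ → Vec n} (hs : M.SolvesMeanField xbar0 Y s xbar) :
    M.SolvesHCM xbar0 P (Y - P) xbar s := by
  obtain ⟨h1, h2, h3, h4, h5⟩ := hs
  simp only [hG, hf, add_zero, Pi.zero_apply, map_zero, sub_zero] at h4 h5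
  refine ⟨?_, h2, h1, h3, fun t ht => (h5 t ht).congr_deriv ?_, fun t ht =>
    (h4 t ht).congr_deriv ?_⟩
  · rw [RiccatiPi, hG, add_zero, Qhat_eq] at hY
    rw [smul_sub, hY, hP, Abar]
    simp only [Matrix.transpose_sub, Matrix.transpose_mul, hPt, hYt, hSt]
    noncomm_ring
  · simp only [Abar, act_sub_left, act_mul, map_add, map_sub]
    abel
  · simp only [add_sub_cancel, Matrix.transpose_sub, Matrix.transpose_smul, Matrix.transpose_one,
      act_sub_left, act_smul_left, act_one]
    abel

/-- Uniqueness of the state of the system of Huang, Caines and Malhamé, and of its feedback. -/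
lemma solvesHCM_unique (hR : M.R.PosDef) (hQ : M.Q.PosSemidef) {xbar0 : Vec n} {P K₁ K₂ : Mat n n}
    (hP : M.RiccatiP P) (hPt : Pᵀ = P) (hK₁ : K₁ᵀ = K₁) (hK₂ : K₂ᵀ = K₂) {x₁ x₂ φ₁ φ₂ : ℝ → Vec n}
    (h₁ : M.SolvesHCM xbar0 P K₁ x₁ φ₁) (h₂ : M.SolvesHCM xbar0 P K₂ x₂ φ₂) :
    EqOn x₁ x₂ (Ici 0) ∧ M.ubreve P K₁ x₁ φ₁ = M.ubreve P K₂ x₂ φ₂ := by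
  have hS := M.posSemidef_S hR
  have hSt := transpose_eq_of_posSemidef hS
  obtain ⟨c₁, d₁, e₁⟩ := M.costate hP hPt hK₁ hSt h₁
  obtain ⟨c₂, d₂, e₂⟩ := M.costate hP hPt hK₂ hSt h₂
  have key := hamiltonian_unique hS (M.posSemidef_Qhat hQ) (h₁.2.2.2.1.trans h₂.2.2.2.1.symm)
    h₁.2.1 h₂.2.1 c₁ c₂ d₁ d₂ e₁ e₂
  refine ⟨fun t ht => (key t ht).1, ?_⟩
  funext t x
  obtain ⟨k1, k2⟩ := key t t.2
  have k3 := M.gain_eq_zero hR k2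
  -- The states agree, so the `P` parts of the costates cancel, leaving equality of the gains
  -- applied to `K x + φ`. This is all that enters the law.
  simp only [k1, map_sub, act_add_left, map_add, sub_eq_zero, add_assoc, add_right_inj] at k3
  simp only [ubreve, k1, map_add, k3]

lemma uhat_eq_ubreve (P Pi : Mat n n) (xbar s : ℝ → Vec n) :
    M.uhat P Pi xbar s = M.ubreve P (Pi - P) xbar s := by
  funext t x
  simp only [uhat, ubreve, add_assoc]

end Model

/-! ### The Wiener integral as an isometric graph between `L²` spaces. -/

section WienerGraph

variable {Ω : Type*} [MeasurableSpace Ω] {μ : Measure Ω} {W : ℝ≥0 → Ω → ℝ}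
variable {E : Type*} [NormedAddCommGroup E] [InnerProductSpace ℝ E]

lemma memLp_smul_const (hW : IsPreBrownianReal W μ) (c : ℝ≥0) (e : E) :
    MemLp (fun ω => W c ω • e) 2 μ :=
  ((ContinuousLinearMap.id ℝ ℝ).smulRight e).comp_memLp'
    (hW.isGaussianProcess.hasGaussianLaw_eval c).memLp_two

lemma integral_mul_brownian (hW : IsPreBrownianReal W μ) (s t : ℝ≥0) :
    ∫ ω, W s ω * W t ω ∂μ = min s t := by
  have := hW.isGaussianProcess.isProbabilityMeasure
  have h := covariance_eq_sub (hW.isGaussianProcess.hasGaussianLaw_eval s).memLp_two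
    (hW.isGaussianProcess.hasGaussianLaw_eval t).memLp_two
  rw [hW.covariance_eval, hW.integral_eval, zero_mul, sub_zero] at h
  exact_mod_cast h.symm

variable (W μ E) in
/-- The generators of the Wiener integral: `1_(0,c] e ↦ W_c e`. -/
noncomputable def wienerGenerators : Set (Lp E 2 (volume : Measure ℝ) × Lp E 2 μ) :=
  {p | ∃ (c : ℝ≥0) (e : E) (h : MemLp (fun ω => W c ω • e) 2 μ),
    p = (indicatorConstLp 2 (measurableSet_Ioc (a := 0) (b := (c : ℝ))) (by simp) e, h.toLp _)}

variable (W μ E) in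
/-- The graph of the Wiener integral as an isometry between `L²` spaces. -/
noncomputable def wienerGraph : Submodule ℝ (Lp E 2 (volume : Measure ℝ) × Lp E 2 μ) :=
  (Submodule.span ℝ (wienerGenerators μ W E)).topologicalClosure

/-- Both sides equal `min c c' · ⟨e, e'⟩`: the length of the overlap of two intervals is the
covariance of Brownian motion. -/
lemma inner_wienerGenerators [CompleteSpace E] (hW : IsPreBrownianReal W μ)
    {p q : Lp E 2 (volume : Measure ℝ) × Lp E 2 μ}
    (hp : p ∈ wienerGenerators μ W E) (hq : q ∈ wienerGenerators μ W E) :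
    inner ℝ p.1 q.1 = inner ℝ p.2 q.2 := by
  obtain ⟨c, e, h, rfl⟩ := hp
  obtain ⟨c', e', h', rfl⟩ := hq
  simp only
  rw [L2.inner_indicatorConstLp_indicatorConstLp _ _ (by simp) (by simp), L2.inner_def]
  have h1 : ∫ ω, inner ℝ (h.toLp _ ω) (h'.toLp _ ω) ∂μ =
      ∫ ω, (W c ω * W c' ω) * inner ℝ e e' ∂μ := by
    refine integral_congr_ae ?_
    filter_upwards [h.coeFn_toLp, h'.coeFn_toLp] with ω h1 h2
    rw [h1, h2, inner_smul_left, inner_smul_right, conj_trivial, mul_assoc]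
  rw [h1, integral_mul_const, integral_mul_brownian hW, Ioc_inter_Ioc]
  simp

lemma inner_eq_of_mem_span [CompleteSpace E] (hW : IsPreBrownianReal W μ)
    {p q : Lp E 2 (volume : Measure ℝ) × Lp E 2 μ}
    (hp : p ∈ Submodule.span ℝ (wienerGenerators μ W E))
    (hq : q ∈ Submodule.span ℝ (wienerGenerators μ W E)) :
    inner ℝ p.1 q.1 = inner ℝ p.2 q.2 := by
  induction hp, hq using Submodule.span_induction₂ with
  | mem_mem p q hp hq => exact inner_wienerGenerators hW hp hq
  | zero_left => simp
  | zero_right => simp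
  | add_left _ _ _ _ _ _ h1 h2 => simp [inner_add_left, h1, h2]
  | add_right _ _ _ _ _ _ h1 h2 => simp [inner_add_right, h1, h2]
  | smul_left _ _ _ _ _ h => simp [inner_smul_left, h]
  | smul_right _ _ _ _ _ h => simp [inner_smul_right, h]

/-- Equality of inner products extends from the generators to their span by bilinearity, and
equality of norms is a closed condition. -/
lemma norm_eq_of_mem_wienerGraph [CompleteSpace E] (hW : IsPreBrownianReal W μ)
    {p : Lp E 2 (volume : Measure ℝ) × Lp E 2 μ} (hp : p ∈ wienerGraph μ W E) :
    ‖p.1‖ = ‖p.2‖ := by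
  have hc : IsClosed {p : Lp E 2 (volume : Measure ℝ) × Lp E 2 μ | ‖p.1‖ = ‖p.2‖} :=
    isClosed_eq (by fun_prop) (by fun_prop)
  refine closure_minimal (fun q hq => ?_) hc hp
  have := inner_eq_of_mem_span hW hq hq
  rw [real_inner_self_eq_norm_sq, real_inner_self_eq_norm_sq] at this
  exact (sq_eq_sq₀ (norm_nonneg _) (norm_nonneg _)).1 this

lemma compLp_toLp {α : Type*} [MeasurableSpace α] {ν : Measure α} (L : E →L[ℝ] E) {f : α → E}
    (hf : MemLp f 2 ν) (hLf : MemLp (fun a => L (f a)) 2 ν) :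
    L.compLp (hf.toLp f) = hLf.toLp _ := by
  refine Lp.ext ?_
  filter_upwards [L.coeFn_compLp (hf.toLp f), hf.coeFn_toLp, hLf.coeFn_toLp] with a h1 h2 h3
  rw [h1, h2, h3]

variable (W μ) in
/-- `Z` is the Wiener integral `∫ f dW` of the square integrable deterministic function `f`. -/
def WienerRel (f : ℝ → E) (Z : Ω → E) : Prop :=
  ∃ (hf : MemLp f 2 volume) (hZ : MemLp Z 2 μ), (hf.toLp f, hZ.toLp Z) ∈ wienerGraph μ W E

namespace WienerRel

variable {f g : ℝ → E} {Y Z : Ω → E}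

lemma memLp (h : WienerRel μ W f Z) : MemLp Z 2 μ := h.2.1

lemma eLpNorm_eq [CompleteSpace E] (hW : IsPreBrownianReal W μ) (h : WienerRel μ W f Z) :
    eLpNorm Z 2 μ = eLpNorm f 2 volume := by
  obtain ⟨hf, hZ, h⟩ := h
  have := norm_eq_of_mem_wienerGraph hW h
  simp only [Lp.norm_toLp] at this
  exact ((ENNReal.toReal_eq_toReal_iff' hf.2.ne hZ.2.ne).1 this).symm

lemma congr (h : WienerRel μ W f Z) (hf : f =ᵐ[volume] g) (hZ : Z =ᵐ[μ] Y) :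
    WienerRel μ W g Y := by
  obtain ⟨h1, h2, h⟩ := h
  refine ⟨h1.ae_eq hf, h2.ae_eq hZ, ?_⟩
  rwa [MemLp.toLp_congr _ h1 hf.symm, MemLp.toLp_congr _ h2 hZ.symm]

lemma brownian (hW : IsPreBrownianReal W μ) (c : ℝ≥0) (e : E) :
    WienerRel μ W ((Ioc 0 (c : ℝ)).indicator fun _ => e) fun ω => W c ω • e :=
  ⟨memLp_indicator_const 2 measurableSet_Ioc e (Or.inr (by simp)), memLp_smul_const hW c e,
    Submodule.le_topologicalClosure _ (Submodule.subset_span ⟨c, e, memLp_smul_const hW c e, rfl⟩)⟩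

lemma zero : WienerRel μ W (0 : ℝ → E) 0 :=
  ⟨MemLp.zero, MemLp.zero, (wienerGraph μ W E).zero_mem⟩

lemma add (h : WienerRel μ W f Z) (h' : WienerRel μ W g Y) : WienerRel μ W (f + g) (Z + Y) := by
  obtain ⟨h1, h2, h3⟩ := h
  obtain ⟨h1', h2', h3'⟩ := h'
  exact ⟨h1.add h1', h2.add h2', (wienerGraph μ W E).add_mem h3 h3'⟩

lemma sub (h : WienerRel μ W f Z) (h' : WienerRel μ W g Y) : WienerRel μ W (f - g) (Z - Y) := by
  obtain ⟨h1, h2, h3⟩ := h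
  obtain ⟨h1', h2', h3'⟩ := h'
  exact ⟨h1.sub h1', h2.sub h2', (wienerGraph μ W E).sub_mem h3 h3'⟩

lemma sum {ι : Type*} {s : Finset ι} {f : ι → ℝ → E} {Z : ι → Ω → E}
    (h : ∀ i ∈ s, WienerRel μ W (f i) (Z i)) :
    WienerRel μ W (∑ i ∈ s, f i) (∑ i ∈ s, Z i) := by
  classical
  induction s using Finset.induction_on with
  | empty => simpa using zero
  | insert a s ha ih =>
    rw [Finset.sum_insert ha, Finset.sum_insert ha]
    exact (h a (Finset.mem_insert_self a s)).add
      (ih fun i hi => h i (Finset.mem_insert_of_mem hi))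

/-- The pairs that `L`, acting on both factors, sends into the graph form a closed subspace
containing the generators. This is what allows the flow to be applied to integrands and integrals
together. -/
lemma clm (h : WienerRel μ W f Z) (L : E →L[ℝ] E) :
    WienerRel μ W (fun u => L (f u)) fun ω => L (Z ω) := by
  obtain ⟨h1, h2, h3⟩ := h
  refine ⟨L.comp_memLp' h1, L.comp_memLp' h2, ?_⟩
  set T : (Lp E 2 (volume : Measure ℝ) × Lp E 2 μ) →L[ℝ] (Lp E 2 (volume : Measure ℝ) × Lp E 2 μ) :=
    (L.compLpL 2 volume).prodMap (L.compLpL 2 μ) with hT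
  have hle : wienerGraph μ W E ≤ (wienerGraph μ W E).comap (T : _ →ₗ[ℝ] _) := by
    refine Submodule.topologicalClosure_minimal _ (Submodule.span_le.2 ?_) ?_
    · rintro p ⟨c, e, h, rfl⟩
      refine Submodule.le_topologicalClosure _ (Submodule.subset_span ⟨c, L e, ?_, ?_⟩)
      · simpa [Function.comp_def] using L.comp_memLp' h
      · refine Prod.ext ?_ ?_
        · have hm : ∀ e : E, MemLp ((Ioc 0 (c : ℝ)).indicator fun _ => e) 2 volume := fun e =>
            memLp_indicator_const 2 measurableSet_Ioc e (Or.inr (by simp))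
          refine (compLp_toLp L (hm e) (L.comp_memLp' (hm e))).trans
            (MemLp.toLp_congr _ (hm (L e)) (ae_of_all _ fun u => ?_))
          by_cases hu : u ∈ Ioc 0 (c : ℝ) <;>
            simp only [indicator, hu, if_true, if_false, map_zero]
        · have hLe : MemLp (fun ω => W c ω • L e) 2 μ := by
            simpa [Function.comp_def] using L.comp_memLp' h
          refine (compLp_toLp L h (L.comp_memLp' h)).trans
            (MemLp.toLp_congr _ hLe (ae_of_all _ fun ω => ?_))
          simp
    · exact (Submodule.isClosed_topologicalClosure _).preimage T.continuous
  have h4 := hle h3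
  rw [Submodule.mem_comap] at h4
  have h5 : T (h1.toLp f, h2.toLp Z) =
      ((L.comp_memLp' h1).toLp fun u => L (f u), (L.comp_memLp' h2).toLp fun ω => L (Z ω)) :=
    Prod.ext (compLp_toLp L h1 (L.comp_memLp' h1)) (compLp_toLp L h2 (L.comp_memLp' h2))
  exact h5 ▸ h4

/-- Closedness: `L²` convergence of the integrands and almost sure convergence of the integrals. -/
lemma of_tendsto [CompleteSpace E] (hW : IsPreBrownianReal W μ) {fm : ℕ → ℝ → E} {Zm : ℕ → Ω → E}
    (h : ∀ m, WienerRel μ W (fm m) (Zm m)) (hf : MemLp f 2 volume)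
    (hlim : Tendsto (fun m => eLpNorm (fm m - f) 2 volume) atTop (𝓝 0))
    (hZ : ∀ᵐ ω ∂μ, Tendsto (fun m => Zm m ω) atTop (𝓝 (Z ω))) : WienerRel μ W f Z := by
  choose h1 h2 h3 using h
  have hF : Tendsto (fun m => (h1 m).toLp (fm m)) atTop (𝓝 (hf.toLp f)) :=
    (Lp.tendsto_Lp_iff_tendsto_eLpNorm'' fm h1 f hf).2 hlim
  -- The isometry transfers the Cauchy property from the integrands to the integrals.
  have hcau : CauchySeq fun m => (h2 m).toLp (Zm m) := by
    have := hF.cauchySeq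
    rw [Metric.cauchySeq_iff] at this ⊢
    intro ε hε
    obtain ⟨N, hN⟩ := this ε hε
    refine ⟨N, fun m hm k hk => ?_⟩
    have e := norm_eq_of_mem_wienerGraph hW ((wienerGraph μ W E).sub_mem (h3 m) (h3 k))
    rw [dist_eq_norm]
    have := hN m hm k hk
    rw [dist_eq_norm] at this
    exact e.symm.trans_lt this
  obtain ⟨Z', hZ'⟩ := cauchySeq_tendsto_of_complete hcau
  have hmem : (hf.toLp f, Z') ∈ wienerGraph μ W E :=
    (Submodule.isClosed_topologicalClosure _).mem_of_tendsto (hF.prodMk_nhds hZ')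
      (Eventually.of_forall h3)
  -- Along a subsequence the `L²` limit is also an almost sure limit, hence equals `Z`.
  have hae : Z' =ᵐ[μ] Z := by
    obtain ⟨ns, hns, hns'⟩ := (tendstoInMeasure_of_tendsto_Lp hZ').exists_seq_tendsto_ae
    filter_upwards [hns', hZ, ae_all_iff.2 fun m => (h2 m).coeFn_toLp] with ω a1 a2 a3
    simp only [a3] at a1
    exact tendsto_nhds_unique a1 (a2.comp hns.tendsto_atTop)
  refine ⟨hf, (Lp.memLp Z').ae_eq hae, ?_⟩
  convert hmem using 2
  exact Lp.ext ((MemLp.coeFn_toLp _).trans hae.symm)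

end WienerRel

end WienerGraph

/-! ### Doob's maximal inequality. -/

section Maximal

variable {Ω : Type*} {m0 : MeasurableSpace Ω} {μ : Measure Ω}

/-- Doob's maximal inequality for martingales indexed by `ℕ`. -/
lemma maximal_ineq_abs [IsFiniteMeasure μ] {F : Filtration ℕ m0} {N : ℕ → Ω → ℝ}
    (hN : Martingale N F μ) {ε : ℝ≥0} (n : ℕ) :
    ε * μ {ω | ∃ k ≤ n, (ε : ℝ) ≤ |N k ω|} ≤ eLpNorm (N n) 1 μ := by
  have hsub : Submartingale (N ⊔ -N) F μ := hN.submartingale.sup hN.neg.submartingale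
  have habs : ∀ k ω, (N ⊔ -N) k ω = |N k ω| := fun k ω => rfl
  have hnn : 0 ≤ N ⊔ -N := fun k ω => by rw [habs]; exact abs_nonneg _
  refine le_trans ?_ ((maximal_ineq hsub hnn (ε := ε) n).trans ?_)
  · refine mul_le_mul' le_rfl (measure_mono ?_)
    rintro ω ⟨k, hk, hk'⟩
    exact hk'.trans (Finset.le_sup' (fun k => (N ⊔ -N) k ω) (Finset.mem_range_succ_iff.2 hk))
  · have hint : Integrable ((N ⊔ -N) n) μ := hsub.integrable n
    rw [eLpNorm_one_eq_lintegral_enorm]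
    refine (ENNReal.ofReal_le_ofReal (setIntegral_le_integral hint
      (ae_of_all _ (hnn n)))).trans ?_
    rw [ofReal_integral_eq_lintegral_ofReal hint (ae_of_all _ (hnn n))]
    refine (lintegral_congr fun ω => ?_).le
    rw [habs, ← Real.norm_eq_abs, ofReal_norm]

/-- Doob's maximal inequality for continuous martingales indexed by `ℝ≥0`. -/
lemma maximal_ineq_continuous [IsFiniteMeasure μ] {F : Filtration ℝ≥0 m0} {M : ℝ≥0 → Ω → ℝ}
    (hM : Martingale M F μ) (hc : ∀ᵐ ω ∂μ, Continuous fun t => M t ω) (ε T : ℝ≥0) :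
    ε * μ {ω | ∃ t ≤ T, (ε : ℝ) < |M t ω|} ≤ eLpNorm (M T) 1 μ := by
  -- Dyadic grids are nested, so these events increase. A strict excess at some time passes by path
  -- continuity to a nearby grid time; hence the strict inequality in the statement and the weak one
  -- here.
  set A : ℕ → Set Ω := fun p => {ω | ∃ k : ℕ, k ≤ 2 ^ p ∧ (ε : ℝ) ≤ |M (T * ((k : ℝ≥0) / 2 ^ p)) ω|} with hA
  have hAle : ∀ p, ε * μ (A p) ≤ eLpNorm (M T) 1 μ := by
    intro p
    set τ : ℕ → ℝ≥0 := fun k => T * ((k : ℝ≥0) / 2 ^ p) with hτ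
    have hτm : Monotone τ := fun a b hab => by
      simp only [hτ]; gcongr
    let G : Filtration ℕ m0 := ⟨fun k => F (τ k), fun a b hab => F.mono (hτm hab),
      fun k => F.le _⟩
    have hN : Martingale (fun k => M (τ k)) G μ :=
      ⟨fun k => hM.1 (τ k), fun a b hab => hM.2 _ _ (hτm hab)⟩
    have h := maximal_ineq_abs hN (ε := ε) (2 ^ p)
    have hT : τ (2 ^ p) = T := by simp [hτ]
    rwa [hT] at h
  have hmono : Monotone A := by
    refine monotone_nat_of_le_succ fun p => ?_
    rintro ω ⟨k, hk, h⟩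
    refine ⟨2 * k, by rw [pow_succ]; omega, ?_⟩
    have : ((2 * k : ℕ) : ℝ≥0) / 2 ^ (p + 1) = (k : ℝ≥0) / 2 ^ p := by
      push_cast
      rw [pow_succ', mul_div_mul_left _ _ two_ne_zero]
    rwa [this]
  have hsub : {ω | ∃ t ≤ T, (ε : ℝ) < |M t ω|} ≤ᵐ[μ] ⋃ p, A p := by
    filter_upwards [hc] with ω hω
    rintro ⟨t, ht, hlt⟩
    refine mem_iUnion.2 ?_
    rcases eq_or_ne T 0 with rfl | hT
    · exact ⟨0, 0, by simp, by simpa [le_zero_iff.1 ht] using hlt.le⟩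
    have hle : (t / T : ℝ) ≤ 1 := by
      rw [div_le_one (by positivity)]
      exact_mod_cast ht
    have h1 : Tendsto (fun p : ℕ => ((⌊(t / T : ℝ) * 2 ^ p⌋₊ : ℝ)) / 2 ^ p) atTop (𝓝 (t / T : ℝ)) :=
      (tendsto_nat_floor_mul_div_atTop (by positivity)).comp
        (tendsto_pow_atTop_atTop_of_one_lt (by norm_num : (1 : ℝ) < 2))
    have h2 : Tendsto (fun p : ℕ => T * ((⌊(t / T : ℝ) * 2 ^ p⌋₊ : ℝ≥0) / 2 ^ p)) atTop (𝓝 t) := by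
      rw [← NNReal.tendsto_coe]
      have := h1.const_mul (T : ℝ)
      rw [mul_div_cancel₀ _ (by exact_mod_cast hT)] at this
      refine this.congr fun p => ?_
      push_cast
      rfl
    have h3 : Tendsto (fun p : ℕ => |M (T * ((⌊(t / T : ℝ) * 2 ^ p⌋₊ : ℝ≥0) / 2 ^ p)) ω|) atTop
        (𝓝 |M t ω|) := ((hω.tendsto t).comp h2).abs
    obtain ⟨p, hp⟩ := (h3.eventually (lt_mem_nhds hlt)).exists
    refine ⟨p, _, ?_, hp.le⟩
    refine Nat.floor_le_of_le ?_
    push_cast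
    exact mul_le_of_le_one_left (by positivity) hle
  calc ε * μ {ω | ∃ t ≤ T, (ε : ℝ) < |M t ω|} ≤ ε * μ (⋃ p, A p) := by
        exact mul_le_mul' le_rfl (measure_mono_ae hsub)
    _ = ⨆ p, ε * μ (A p) := by rw [hmono.measure_iUnion, ENNReal.mul_iSup]
    _ ≤ _ := iSup_le hAle

end Maximal

/-! ### Brownian motion stopped at a deterministic time. -/

section BrownianMartingale

variable {Ω : Type*} {m0 : MeasurableSpace Ω} {μ : Measure Ω} {W : ℝ≥0 → Ω → ℝ}

/-- The increments after `s` are independent of the past and have mean zero. -/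
lemma condExp_brownian (hW : IsPreBrownianReal W μ) (hm : ∀ t, StronglyMeasurable (W t))
    {s t : ℝ≥0} (hst : s ≤ t) : μ[W t | Filtration.natural W hm s] =ᵐ[μ] W s := by
  have := hW.isGaussianProcess.isProbabilityMeasure
  set F := Filtration.natural W hm
  have hmeas : ∀ r, Measurable (W r) := fun r => (hm r).measurable
  have hind := hW.indepFun_shift s
  rw [IndepFun_iff_Indep, ← Filtration.natural_eq_comap W hm s] at hind
  have hz : μ[W t - W s | F s] =ᵐ[μ] fun _ => μ[W t - W s] := by
    refine condExp_indep_eq ?_ (F.le s) ?_ hind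
    · exact (measurable_pi_lambda _ fun t => (hmeas (s + t)).sub (hmeas s)).comap_le
    · have e : W t - W s = (fun f : ℝ≥0 → ℝ => f (t - s)) ∘ fun ω r => W (s + r) ω - W s ω := by
        ext ω
        simp [add_tsub_cancel_of_le hst]
      rw [e]
      exact (Measurable.comp (measurable_pi_apply (X := fun _ : ℝ≥0 => ℝ) (t - s)) (comap_measurable _)).stronglyMeasurable
  have h0 : μ[W t - W s] = 0 := by
    rw [integral_sub' (hW.integrable_eval t) (hW.integrable_eval s), hW.integral_eval,
      hW.integral_eval, sub_zero]
  have hs : μ[W s | F s] = W s := condExp_of_stronglyMeasurable (F.le s)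
    (Filtration.stronglyAdapted_natural hm s) (hW.integrable_eval s)
  have hadd := condExp_add (hW.integrable_eval t |>.sub (hW.integrable_eval s))
    (hW.integrable_eval s) (F s)
  rw [sub_add_cancel, hs] at hadd
  filter_upwards [hadd, hz] with ω h1 h2
  rw [h1, Pi.add_apply, h2, h0, zero_add]

lemma martingale_min (hW : IsPreBrownianReal W μ) (hm : ∀ t, StronglyMeasurable (W t)) (c : ℝ≥0) :
    Martingale (fun t => W (min t c)) (Filtration.natural W hm) μ := by
  have := hW.isGaussianProcess.isProbabilityMeasure
  have had := Filtration.stronglyAdapted_natural hm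
  refine ⟨fun t => (had (min t c)).mono ((Filtration.natural W hm).mono (min_le_left _ _)),
    fun s t hst => ?_⟩
  change μ[W (min t c) | Filtration.natural W hm s] =ᵐ[μ] W (min s c)
  rcases le_total s c with h | h
  · rw [min_eq_left h]
    exact condExp_brownian hW hm (le_min hst h)
  · rw [min_eq_right h, min_eq_right (h.trans hst),
      condExp_of_stronglyMeasurable ((Filtration.natural W hm).le s)
        ((had c).mono ((Filtration.natural W hm).mono h)) (hW.integrable_eval c)]

end BrownianMartingale

/-! ### Uniform partitions and piecewise approximation. -/

section Grid

variable {E : Type*} [NormedAddCommGroup E]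

/-- The `k`-th point of the uniform partition of `[0,T]` into `m + 1` intervals. -/
noncomputable def grid (T : ℝ≥0) (m k : ℕ) : ℝ≥0 := T * (k : ℝ≥0) / (m + 1)

lemma grid_mono (T : ℝ≥0) (m : ℕ) : Monotone (grid T m) := fun a b hab => by
  unfold grid
  gcongr

lemma grid_zero (T : ℝ≥0) (m : ℕ) : grid T m 0 = 0 := by simp [grid]

lemma grid_last (T : ℝ≥0) (m : ℕ) : grid T m (m + 1) = T := by
  have : (m : ℝ≥0) + 1 ≠ 0 := by positivity
  simp [grid, this]

lemma grid_le (T : ℝ≥0) {m k : ℕ} (hk : k ≤ m + 1) : grid T m k ≤ T :=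
  (grid_mono T m hk).trans (grid_last T m).le

lemma grid_succ_sub (T : ℝ≥0) (m k : ℕ) :
    (grid T m (k + 1) : ℝ) - grid T m k = T / (m + 1) := by
  simp only [grid]
  push_cast
  ring

lemma sum_indicator_Ioc (a : ℕ → ℝ≥0) (ha : Monotone a) (h : ℝ → E) (n : ℕ) :
    ∑ k ∈ Finset.range n, (Ioc (a k : ℝ) (a (k + 1))).indicator h = (Ioc (a 0 : ℝ) (a n)).indicator h := by
  induction n with
  | zero => simp; rfl
  | succ n ih =>
    have h1 : (a 0 : ℝ) ≤ a n := by exact_mod_cast ha (Nat.zero_le n)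
    have h2 : (a n : ℝ) ≤ a (n + 1) := by exact_mod_cast ha (Nat.le_succ n)
    rw [Finset.sum_range_succ, ih, ← Ioc_union_Ioc_eq_Ioc h1 h2,
      indicator_union_of_disjoint (Ioc_disjoint_Ioc_of_le le_rfl)]
    rfl

/-- A piecewise approximation of `g` within `ε` on a partition is close to `g` in `L²`. -/
lemma eLpNorm_sum_indicator_sub_le {a : ℕ → ℝ≥0} (ha : Monotone a) {n : ℕ} (c : ℕ → ℝ → E)
    (g : ℝ → E) {ε : ℝ} (hε : 0 ≤ ε)
    (h : ∀ k < n, ∀ u ∈ Ioc (a k : ℝ) (a (k + 1)), ‖c k u - g u‖ ≤ ε) :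
    eLpNorm (∑ k ∈ Finset.range n, (Ioc (a k : ℝ) (a (k + 1))).indicator (c k)
      - (Ioc (a 0 : ℝ) (a n)).indicator g) 2 volume ≤
      ENNReal.ofReal (ε * Real.sqrt (a n)) := by
  have hle : ∀ u, ‖(∑ k ∈ Finset.range n, (Ioc (a k : ℝ) (a (k + 1))).indicator (c k)
      - (Ioc (a 0 : ℝ) (a n)).indicator g) u‖ ≤ ‖(Ioc (a 0 : ℝ) (a n)).indicator (fun _ => ε) u‖ := by
    intro u
    rw [← sum_indicator_Ioc a ha g n, ← sum_indicator_Ioc a ha (fun _ => ε) n,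
      ← Finset.sum_sub_distrib, Finset.sum_apply, Finset.sum_apply, Real.norm_of_nonneg]
    · refine norm_sum_le_of_le _ fun k hk => ?_
      rw [Pi.sub_apply]
      by_cases hu : u ∈ Ioc (a k : ℝ) (a (k + 1))
      · simpa only [indicator_of_mem hu] using h k (Finset.mem_range.1 hk) u hu
      · simp only [indicator_of_notMem hu, sub_zero, norm_zero, le_refl]
    · exact Finset.sum_nonneg fun k _ => indicator_nonneg (fun _ _ => hε) u
  refine (eLpNorm_mono hle).trans ?_
  rw [eLpNorm_indicator_const measurableSet_Ioc two_ne_zero ENNReal.ofNat_ne_top, Real.volume_Ioc,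
    Real.enorm_eq_ofReal hε, ENNReal.ofReal_mul hε, Real.sqrt_eq_rpow,
    ← ENNReal.ofReal_rpow_of_nonneg (by positivity) (by norm_num)]
  refine mul_le_mul' le_rfl (ENNReal.rpow_le_rpow (ENNReal.ofReal_le_ofReal ?_) (by norm_num))
  exact sub_le_self _ (a 0).2

lemma exists_grid_close {g : ℝ → E} (hg : ContinuousOn g (Ici 0)) (T : ℝ≥0) {ε : ℝ} (hε : 0 < ε) :
    ∃ m₀ : ℕ, ∀ m ≥ m₀, ∀ u v : ℝ, u ∈ Icc 0 (T : ℝ) → v ∈ Icc 0 (T : ℝ) → |u - v| ≤ T / (m + 1) →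
      ‖g u - g v‖ ≤ ε := by
  have huc : UniformContinuousOn g (Icc 0 (T : ℝ)) :=
    isCompact_Icc.uniformContinuousOn_of_continuous (hg.mono Icc_subset_Ici_self)
  obtain ⟨δ, hδ, h⟩ := Metric.uniformContinuousOn_iff.1 huc ε hε
  have hlim : Tendsto (fun m : ℕ => (T : ℝ) / ((m : ℝ) + 1)) atTop (𝓝 0) :=
    tendsto_const_nhds.div_atTop (tendsto_atTop_add_const_right _ _ tendsto_natCast_atTop_atTop)
  obtain ⟨m₀, hm₀⟩ := eventually_atTop.1 (hlim.eventually (gt_mem_nhds hδ))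
  refine ⟨m₀, fun m hm u v hu hv huv => ?_⟩
  have := h u hu v hv (by rw [Real.dist_eq]; exact huv.trans_lt (hm₀ m hm))
  rw [dist_eq_norm] at this
  exact this.le

end Grid

/-! ### Left endpoint sums as continuous martingales. -/

section LeftSum

variable {Ω : Type*} {m0 : MeasurableSpace Ω} {μ : Measure Ω} {W : ℝ≥0 → Ω → ℝ} {n : ℕ}

variable (W) in
/-- Left endpoint sums of `∫₀ᵗ g dW` over the uniform partition of `[0,T]`. -/
noncomputable def leftSum (g : ℝ → Vec n) (T : ℝ≥0) (m : ℕ) (t : ℝ≥0) (ω : Ω) : Vec n :=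
  ∑ k ∈ Finset.range (m + 1),
    (W (min t (grid T m (k + 1))) ω - W (min t (grid T m k)) ω) • g (grid T m k)

lemma leftSum_zero (g : ℝ → Vec n) (T : ℝ≥0) (m : ℕ) (ω : Ω) : leftSum W g T m 0 ω = 0 := by
  simp [leftSum]

lemma continuous_leftSum (g : ℝ → Vec n) (T : ℝ≥0) (m : ℕ) {ω : Ω}
    (hω : Continuous fun t => W t ω) : Continuous fun t => leftSum W g T m t ω := by
  unfold leftSum
  fun_prop

lemma measurable_leftSum {m' : MeasurableSpace Ω} (g : ℝ → Vec n) (T : ℝ≥0) (m : ℕ) (t : ℝ≥0)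
    (hW : ∀ s ≤ t, Measurable[m'] (W s)) : Measurable[m'] (leftSum W g T m t) := by
  unfold leftSum
  refine Finset.measurable_fun_sum _ fun k _ => ?_
  exact ((hW _ (min_le_left _ _)).sub (hW _ (min_le_left _ _))).smul_const _

lemma WienerRel.increment {E : Type*} [NormedAddCommGroup E] [InnerProductSpace ℝ E]
    (hW : IsPreBrownianReal W μ) {a b : ℝ≥0} (hab : a ≤ b) (e : E) :
    WienerRel μ W ((Ioc (a : ℝ) b).indicator fun _ => e) fun ω => (W b ω - W a ω) • e := by
  refine ((WienerRel.brownian hW b e).sub (WienerRel.brownian hW a e)).congr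
    (ae_of_all _ fun u => ?_) (ae_of_all _ fun ω => ?_)
  · have hab' : (a : ℝ) ≤ b := by exact_mod_cast hab
    have ha : (0 : ℝ) ≤ a := a.2
    rw [← Ioc_union_Ioc_eq_Ioc ha hab',
      indicator_union_of_disjoint (Ioc_disjoint_Ioc_of_le le_rfl)]
    simp
  · simp [sub_smul]

lemma wienerRel_leftSum (hW : IsPreBrownianReal W μ) (g : ℝ → Vec n) (T : ℝ≥0) (m : ℕ) (t : ℝ≥0) :
    WienerRel μ W (∑ k ∈ Finset.range (m + 1),
      (Ioc ((min t (grid T m k) : ℝ≥0) : ℝ) (min t (grid T m (k + 1)) : ℝ≥0)).indicator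
        fun _ => g (grid T m k)) (leftSum W g T m t) := by
  refine (WienerRel.sum fun k _ => WienerRel.increment hW
    (min_le_min_left t (grid_mono T m k.le_succ)) (g (grid T m k))).congr EventuallyEq.rfl
    (ae_of_all _ fun ω => ?_)
  simp [leftSum]

/-- The left endpoint sums approximate the Wiener integral, uniformly on `[0,T]`. -/
lemma exists_leftSum_approx (hW : IsPreBrownianReal W μ) {g : ℝ → Vec n}
    (hg : ContinuousOn g (Ici 0)) (T : ℝ≥0) {ε : ℝ} (hε : 0 < ε) :
    ∃ m₀ : ℕ, ∀ m ≥ m₀, ∀ t ≤ T, ∃ F : ℝ → Vec n, WienerRel μ W F (leftSum W g T m t) ∧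
      eLpNorm (F - (Ioc 0 (t : ℝ)).indicator g) 2 volume ≤ ENNReal.ofReal ε := by
  -- A uniform error on an interval of length at most `T` costs a factor `√T` in `L²`; the `+ 1`
  -- covers `T = 0`.
  obtain ⟨m₀, hm₀⟩ := exists_grid_close hg T (ε := ε / (Real.sqrt T + 1)) (by positivity)
  refine ⟨m₀, fun m hm t ht => ⟨_, wienerRel_leftSum hW g T m t, ?_⟩⟩
  have hmono : Monotone fun k => min t (grid T m k) := fun a b hab =>
    min_le_min_left t (grid_mono T m hab)
  have h := eLpNorm_sum_indicator_sub_le hmono (n := m + 1)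
    (fun k _ => g (grid T m k)) g (ε := ε / (Real.sqrt T + 1)) (by positivity) ?_
  · simp only [grid_zero, grid_last, min_eq_left ht, min_eq_right (zero_le (a := t)), NNReal.coe_zero] at h
    refine h.trans (ENNReal.ofReal_le_ofReal ?_)
    rw [div_mul_eq_mul_div, div_le_iff₀ (by positivity)]
    have : Real.sqrt t ≤ Real.sqrt T := Real.sqrt_le_sqrt (by exact_mod_cast ht)
    nlinarith
  · intro k hk u hu
    -- If `t` were at most the left grid point, the truncated cell would be empty; so a cell
    -- containing `u` has its true left end below `u`.
    have h1 : (grid T m k : ℝ) < u := by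
      by_contra! hcon
      have h2 : (min t (grid T m k) : ℝ≥0) < u := by exact hu.1
      have h3 : u ≤ (min t (grid T m (k + 1)) : ℝ≥0) := hu.2
      simp only [NNReal.coe_min] at h2 h3
      rcases min_lt_iff.1 h2 with h4 | h4
      · exact absurd (h3.trans (min_le_left _ _)) (not_le.2 h4)
      · exact absurd hcon (not_le.2 h4)
    have h2 : u ≤ grid T m (k + 1) := by
      have h3 : u ≤ (min t (grid T m (k + 1)) : ℝ≥0) := hu.2
      exact h3.trans (by exact_mod_cast min_le_right _ _)
    have h4 : (grid T m (k + 1) : ℝ) ≤ T := by exact_mod_cast grid_le T (by omega)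
    refine hm₀ m hm _ _ ⟨by positivity, (h1.le.trans h2).trans h4⟩
      ⟨(by positivity : (0 : ℝ) ≤ grid T m k).trans h1.le, h2.trans h4⟩ ?_
    rw [← grid_succ_sub T m k, abs_sub_comm, abs_of_pos (by linarith)]
    linarith

/-- Each summand is a fixed multiple of a difference of stopped Brownian motions. Truncating by `min
t` in the sums serves this purpose. -/
lemma martingale_leftSum (hW : IsPreBrownianReal W μ) (hm : ∀ t, StronglyMeasurable (W t))
    (g : ℝ → Vec n) (T : ℝ≥0) (m : ℕ) (i : Fin n) :
    Martingale (fun t ω => leftSum W g T m t ω i) (Filtration.natural W hm) μ := by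
  have hsum : ∀ s : Finset ℕ, Martingale (∑ k ∈ s, (g (grid T m k) i) •
      ((fun t => W (min t (grid T m (k + 1)))) - fun t => W (min t (grid T m k))))
      (Filtration.natural W hm) μ := by
    intro s
    induction s using Finset.induction_on with
    | empty => simpa using martingale_zero _ _ _
    | insert a s ha ih =>
      rw [Finset.sum_insert ha]
      exact (((martingale_min hW hm _).sub (martingale_min hW hm _)).smul _).add ih
  convert hsum (Finset.range (m + 1)) using 1
  ext t ω
  simp [leftSum, Finset.sum_apply, mul_comm]

lemma norm_le_sum_abs (x : Vec n) : ‖x‖ ≤ ∑ i, |x i| := by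
  have h : x = ∑ i, x i • EuclideanSpace.single i (1 : ℝ) := by
    ext j
    simp [Finset.sum_apply, Pi.single_apply]
  conv_lhs => rw [h]
  refine (norm_sum_le _ _).trans (Finset.sum_le_sum fun i _ => ?_)
  rw [norm_smul]
  simp

/-- A maximal inequality for vector valued continuous processes whose coordinates are
martingales. -/
lemma maximal_ineq_vec [IsProbabilityMeasure μ] {F : Filtration ℝ≥0 m0} {M : ℝ≥0 → Ω → Vec n}
    (hM : ∀ i, Martingale (fun t ω => M t ω i) F μ)
    (hc : ∀ᵐ ω ∂μ, Continuous fun t => M t ω) {T : ℝ≥0} (hT : AEStronglyMeasurable (M T) μ)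
    {ε : ℝ≥0} (hε : ε ≠ 0) :
    μ {ω | ∃ t ≤ T, (ε : ℝ) < ‖M t ω‖} ≤ n * (((n + 1) / ε : ℝ≥0) * eLpNorm (M T) 2 μ) := by
  -- If all `n` coordinates stay within `δ`, the norm is at most `n δ ≤ ε`; `n + 1` avoids division
  -- by zero.
  set δ : ℝ≥0 := ε / (n + 1) with hδ
  have hδ0 : δ ≠ 0 := by positivity
  have hδi : (((n + 1) / ε : ℝ≥0) : ℝ≥0∞) = (δ : ℝ≥0∞)⁻¹ := by
    rw [← ENNReal.coe_inv hδ0, hδ, inv_div]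
  have hi : ∀ i : Fin n, μ {ω | ∃ t ≤ T, (δ : ℝ) < |M t ω i|} ≤
      ((n + 1) / ε : ℝ≥0) * eLpNorm (M T) 2 μ := by
    intro i
    have h1 := maximal_ineq_continuous (hM i)
      (hc.mono fun ω h => (EuclideanSpace.proj (𝕜 := ℝ) i).continuous.comp h) δ T
    have h2 : eLpNorm (fun ω => M T ω i) 1 μ ≤ eLpNorm (M T) 2 μ := by
      refine (eLpNorm_mono (g := M T) fun ω => ?_).trans
        (eLpNorm_le_eLpNorm_of_exponent_le one_le_two hT)
      exact PiLp.norm_apply_le (M T ω) i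
    rw [hδi, ← ENNReal.div_eq_inv_mul, ENNReal.le_div_iff_mul_le (by simp [hδ0]) (by simp), mul_comm]
    exact h1.trans h2
  have hsub : {ω | ∃ t ≤ T, (ε : ℝ) < ‖M t ω‖} ⊆ ⋃ i : Fin n, {ω | ∃ t ≤ T, (δ : ℝ) < |M t ω i|} := by
    rintro ω ⟨t, ht, h⟩
    by_contra hcon
    simp only [mem_iUnion, mem_ofPred_eq, not_exists, not_and, not_lt] at hcon
    have h1 : ‖M t ω‖ ≤ ∑ _i : Fin n, (δ : ℝ) :=
      (norm_le_sum_abs _).trans (Finset.sum_le_sum fun i _ => hcon i t ht)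
    rw [Finset.sum_const, Finset.card_univ, Fintype.card_fin, nsmul_eq_mul, hδ] at h1
    have h2 : (n : ℝ) * ((ε / (n + 1) : ℝ≥0) : ℝ) ≤ ε := by
      push_cast
      rw [mul_div_assoc', div_le_iff₀ (by positivity)]
      nlinarith [ε.2]
    linarith
  calc _ ≤ μ (⋃ i : Fin n, {ω | ∃ t ≤ T, (δ : ℝ) < |M t ω i|}) := measure_mono hsub
    _ ≤ ∑ i : Fin n, μ {ω | ∃ t ≤ T, (δ : ℝ) < |M t ω i|} := measure_iUnion_fintype_le _ _
    _ ≤ ∑ _i : Fin n, ((n + 1) / ε : ℝ≥0) * eLpNorm (M T) 2 μ := Finset.sum_le_sum fun i _ => hi i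
    _ = _ := by simp

end LeftSum

/-- A sequence of continuous functions whose increments are locally eventually geometrically small
has a continuous limit. -/
lemma exists_continuous_limit {E : Type*} [NormedAddCommGroup E] [CompleteSpace E]
    {F : ℕ → ℝ≥0 → E} (hF : ∀ m, Continuous (F m))
    (h : ∀ᶠ m : ℕ in atTop, ∀ t ≤ (m : ℝ≥0), ‖F (m + 1) t - F m t‖ ≤ (1 / 2) ^ m) :
    ∃ L : ℝ≥0 → E, Continuous L ∧ ∀ t, Tendsto (fun m => F m t) atTop (𝓝 (L t)) := by
  obtain ⟨m₀, hm₀⟩ := eventually_atTop.1 h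
  have hu : ∀ m ≥ m₀, ∀ t ≤ (m : ℝ≥0), ∀ k : ℕ,
      dist (F (m + k) t) (F (m + (k + 1)) t) ≤ (1 / 2) ^ m * (1 / 2) ^ k := by
    intro m hm t ht k
    rw [dist_comm, dist_eq_norm, ← add_assoc, ← pow_add]
    exact hm₀ (m + k) (by omega) t (ht.trans (by exact_mod_cast Nat.le_add_right m k))
  have hex : ∀ t, ∃ l, Tendsto (fun m => F m t) atTop (𝓝 l) := by
    intro t
    -- The increments are controlled only up to time `m`, so the geometric series at `t` must start
    -- at an index beyond `t`.
    set m := max m₀ ⌈t⌉₊ with hm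
    have ht : t ≤ (m : ℝ≥0) := (Nat.le_ceil t).trans (by exact_mod_cast le_max_right _ _)
    obtain ⟨l, hl⟩ := cauchySeq_tendsto_of_complete (cauchySeq_of_le_geometric _ _ (by norm_num)
      (hu m (le_max_left _ _) t ht))
    refine ⟨l, (tendsto_add_atTop_iff_nat m).1 ?_⟩
    simpa [add_comm] using hl
  choose L hL using hex
  have hb : ∀ m ≥ m₀, ∀ t ≤ (m : ℝ≥0), dist (F m t) (L t) ≤ (1 / 2) ^ m * 2 := by
    intro m hm t ht
    have h1 : Tendsto (fun k => F (m + k) t) atTop (𝓝 (L t)) := by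
      simpa [add_comm] using (tendsto_add_atTop_iff_nat m).2 (hL t)
    have := dist_le_of_le_geometric_of_tendsto₀ _ _ (by norm_num) (hu m hm t ht) h1
    norm_num at this ⊢
    linarith
  refine ⟨L, ?_, hL⟩
  have hlu : TendstoLocallyUniformly F L atTop := by
    rw [Metric.tendstoLocallyUniformly_iff]
    intro ε hε x
    refine ⟨Iic (x + 1), Iic_mem_nhds (by simp), ?_⟩
    have hsm : Tendsto (fun m : ℕ => (1 / 2 : ℝ) ^ m * 2) atTop (𝓝 0) := by
      simpa using (tendsto_pow_atTop_nhds_zero_of_lt_one (by norm_num : (0 : ℝ) ≤ 1 / 2)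
        (by norm_num)).mul_const 2
    filter_upwards [hsm.eventually (gt_mem_nhds hε), eventually_ge_atTop m₀,
      eventually_ge_atTop ⌈x + 1⌉₊] with m h1 h2 h3 y hy
    rw [dist_comm]
    refine (hb m h2 y (le_trans hy ((Nat.le_ceil _).trans (by exact_mod_cast h3)))).trans_lt h1
  exact hlu.continuous (Eventually.of_forall hF).frequently

/-! ### A continuous version of the Wiener integral. -/

section ContinuousVersion

variable {Ω : Type*} {m0 : MeasurableSpace Ω} {μ : Measure Ω} {W : ℝ≥0 → Ω → ℝ} {n : ℕ}

lemma memLp_indicator_Ioc {E : Type*} [NormedAddCommGroup E] {g : ℝ → E}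
    (hg : ContinuousOn g (Ici 0)) (t : ℝ) : MemLp ((Ioc 0 t).indicator g) 2 volume := by
  rw [memLp_indicator_iff_restrict measurableSet_Ioc]
  have hc : ContinuousOn g (Icc 0 t) := hg.mono Icc_subset_Ici_self
  obtain ⟨C, hC⟩ := isCompact_Icc.exists_bound_of_continuousOn hc
  have : IsFiniteMeasure (volume.restrict (Ioc (0 : ℝ) t)) := ⟨by simp⟩
  refine MemLp.of_bound (C := C) ?_ ?_
  · exact (hc.mono Ioc_subset_Icc_self).aestronglyMeasurable measurableSet_Ioc
  · filter_upwards [ae_restrict_mem measurableSet_Ioc] with u hu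
    exact hC u (Ioc_subset_Icc_self hu)

lemma stronglyMeasurable_limUnder {Ω : Type*} {m' : MeasurableSpace Ω} {f : ℕ → Ω → Vec n}
    (hf : ∀ j, Measurable (f j)) : StronglyMeasurable fun ω => limUnder atTop fun j => f j ω :=
  StronglyMeasurable.limUnder fun j => (hf j).stronglyMeasurable

/-- The Wiener integral of a continuous function has a continuous version. -/
theorem exists_continuous_wienerIntegral (hW : IsBrownianReal W μ) (hm : ∀ t, Measurable (W t))
    {g : ℝ → Vec n} (hg : ContinuousOn g (Ici 0)) :
    ∃ J : ℝ≥0 → Ω → Vec n, (∀ t, Measurable (J t)) ∧ (∀ ω, Continuous fun t => J t ω) ∧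
      (∀ ω, J 0 ω = 0) ∧
      (∀ t, ∃ Z : Ω → Vec n, StronglyMeasurable[⨆ s : Iic t, MeasurableSpace.comap (W s) inferInstance]
        Z ∧ J t =ᵐ[μ] Z) ∧
      ∀ t : ℝ≥0, WienerRel μ W ((Ioc 0 (t : ℝ)).indicator g) (J t) := by
  have hpre := hW.toIsPreBrownianReal
  have := hpre.isGaussianProcess.isProbabilityMeasure
  have hsm : ∀ t, StronglyMeasurable (W t) := fun t => (hm t).stronglyMeasurable
  -- The `j`-th approximation has horizon `j` and accuracy `8⁻ʲ`, so horizons exhaust the half-line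
  -- while errors remain summable.
  choose p hp using fun j : ℕ => exists_leftSum_approx hpre hg (j : ℝ≥0)
    (ε := (1 / 8) ^ j) (by positivity)
  set N : ℕ → ℝ≥0 → Ω → Vec n := fun j t => leftSum W g j (p j) t with hN
  have hrel : ∀ j : ℕ, ∀ t ≤ (j : ℝ≥0), ∃ F : ℝ → Vec n, WienerRel μ W F (N j t) ∧
      eLpNorm (F - (Ioc 0 (t : ℝ)).indicator g) 2 volume ≤ ENNReal.ofReal ((1 / 8) ^ j) :=
    fun j t ht => hp j (p j) le_rfl t ht
  have hNm : ∀ j t, Measurable (N j t) := fun j t => measurable_leftSum _ _ _ _ fun s _ => hm s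
  have hdiff : ∀ j : ℕ, eLpNorm (N (j + 1) j - N j j) 2 μ ≤ ENNReal.ofReal (2 * (1 / 8) ^ j) := by
    intro j
    obtain ⟨F, hF, hF'⟩ := hrel j j le_rfl
    obtain ⟨G, hG, hG'⟩ := hrel (j + 1) j (by exact_mod_cast j.le_succ)
    rw [(hG.sub hF).eLpNorm_eq hpre]
    have hmem := memLp_indicator_Ioc hg ((j : ℝ≥0) : ℝ)
    have e : G - F = (G - (Ioc 0 (((j : ℝ≥0) : ℝ))).indicator g)
        - (F - (Ioc 0 (((j : ℝ≥0) : ℝ))).indicator g) := by abel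
    rw [e]
    refine (eLpNorm_sub_le (hG.1.1.sub hmem.1) (hF.1.1.sub hmem.1) one_le_two).trans
      ((add_le_add hG' hF').trans ?_)
    rw [← ENNReal.ofReal_add (by positivity) (by positivity)]
    refine ENNReal.ofReal_le_ofReal ?_
    rw [pow_succ]
    have : (0 : ℝ) ≤ (1 / 8) ^ j := by positivity
    linarith
  have hNc : ∀ᵐ ω ∂μ, ∀ j, Continuous fun t => N j t ω := by
    filter_upwards [hW.cont] with ω hω j using continuous_leftSum g _ _ hω
  -- The threshold `2⁻ʲ` costs a factor `2ʲ` against the `L²` error `2 · 8⁻ʲ`, leaving a multiple of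
  -- `4⁻ʲ`. This is summable, so Borel–Cantelli applies.
  have hE : ∀ j : ℕ, μ {ω | ∃ t ≤ (j : ℝ≥0), (((1 / 2) ^ j : ℝ≥0) : ℝ) < ‖N (j + 1) t ω - N j t ω‖} ≤
      (n * (2 * (n + 1)) : ℝ≥0) * ((1 / 4 : ℝ≥0) : ℝ≥0∞) ^ j := by
    intro j
    refine (maximal_ineq_vec (M := fun t ω => N (j + 1) t ω - N j t ω)
      (fun i => (martingale_leftSum hpre hsm g _ _ i).sub (martingale_leftSum hpre hsm g _ _ i))
      (hNc.mono fun ω h => (h (j + 1)).sub (h j))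
      ((hNm _ _).sub (hNm _ _)).aestronglyMeasurable (by positivity)).trans ?_
    calc _ ≤ (n : ℝ≥0∞) * (((n + 1) / (1 / 2) ^ j : ℝ≥0) * ENNReal.ofReal (2 * (1 / 8) ^ j)) := by
          gcongr
          exact hdiff j
      _ = ((n * ((n + 1) / (1 / 2) ^ j * (2 * (1 / 8) ^ j)) : ℝ≥0) : ℝ≥0∞) := by
          have : ENNReal.ofReal (2 * (1 / 8) ^ j) = ((2 * (1 / 8) ^ j : ℝ≥0) : ℝ≥0∞) := by
            rw [← ENNReal.ofReal_coe_nnreal]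
            push_cast
            rfl
          rw [this]
          push_cast
          rfl
      _ ≤ _ := by
          rw [← ENNReal.coe_pow, ← ENNReal.coe_mul, ENNReal.coe_le_coe]
          refine le_of_eq ?_
          have h8 : (1 / 8 : ℝ≥0) ^ j = (1 / 2) ^ j * (1 / 4) ^ j := by
            rw [← mul_pow]; norm_num
          have h2 : (1 / 2 : ℝ≥0) ^ j ≠ 0 := by positivity
          rw [h8]
          field_simp
  have hsum : ∑' j : ℕ, μ {ω | ∃ t ≤ (j : ℝ≥0),
      (((1 / 2) ^ j : ℝ≥0) : ℝ) < ‖N (j + 1) t ω - N j t ω‖} ≠ ∞ := by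
    refine ne_top_of_le_ne_top ?_ (ENNReal.tsum_le_tsum hE)
    rw [ENNReal.tsum_mul_left, ENNReal.tsum_geometric]
    refine ENNReal.mul_ne_top ENNReal.coe_ne_top (ENNReal.inv_ne_top.2 ?_)
    rw [Ne, tsub_eq_zero_iff_le, not_le]
    exact_mod_cast (by norm_num : (1 / 4 : ℝ≥0) < 1)
  have hgood : ∀ᵐ ω ∂μ, ∃ L : ℝ≥0 → Vec n, Continuous L ∧
      ∀ t, Tendsto (fun j => N j t ω) atTop (𝓝 (L t)) := by
    filter_upwards [ae_eventually_notMem hsum, hNc] with ω h1 h2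
    refine exists_continuous_limit h2 (h1.mono fun j hj t ht => ?_)
    by_contra! hcon
    exact hj ⟨t, ht, by push_cast; exact hcon⟩
  -- Setting the process to zero on a measurable null set makes it measurable with every path
  -- continuous, not just almost every one.
  obtain ⟨S, hSsub, hSm, hS0⟩ := exists_measurable_superset_of_null (ae_iff.1 hgood)
  have hgood' : ∀ ω ∉ S, ∃ L : ℝ≥0 → Vec n, Continuous L ∧
      ∀ t, Tendsto (fun j => N j t ω) atTop (𝓝 (L t)) := fun ω hω => by
    by_contra hcon
    exact hω (hSsub hcon)
  classical
  set J : ℝ≥0 → Ω → Vec n := fun t ω =>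
    if h : ω ∉ S then (hgood' ω h).choose t else 0 with hJ
  have hJt : ∀ ω ∉ S, ∀ t, Tendsto (fun j => N j t ω) atTop (𝓝 (J t ω)) := fun ω hω t => by
    simp only [hJ, dif_pos hω]
    exact (hgood' ω hω).choose_spec.2 t
  have hSae : ∀ᵐ ω ∂μ, ω ∉ S := measure_eq_zero_iff_ae_notMem.1 hS0
  refine ⟨J, fun t => ?_, fun ω => ?_, fun ω => ?_, fun t => ?_, fun t => ?_⟩
  · refine measurable_of_tendsto_metrizable (f := fun j => Sᶜ.indicator (N j t))
      (fun j => (hNm j t).indicator hSm.compl) (tendsto_pi_nhds.2 fun ω => ?_)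
    by_cases hω : ω ∈ S
    · simp [hJ, hω]
    · simpa [hω] using hJt ω hω t
  · by_cases hω : ω ∈ S
    · simp only [hJ, not_not.2 hω, dif_neg, not_false_eq_true]
      exact continuous_const
    · simp only [hJ, dif_pos hω]
      exact (hgood' ω hω).choose_spec.1
  · by_cases hω : ω ∈ S
    · simp [hJ, hω]
    · refine tendsto_nhds_unique (hJt ω hω 0) ?_
      simp only [hN, leftSum_zero]
      exact tendsto_const_nhds
  · refine ⟨fun ω => limUnder atTop fun j => N j t ω, ?_, ?_⟩
    · refine stronglyMeasurable_limUnder fun j => measurable_leftSum _ _ _ _ fun s hs => ?_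
      exact (comap_measurable (W s)).mono (le_iSup_of_le (⟨s, hs⟩ : Iic t) le_rfl) le_rfl
    · filter_upwards [hSae] with ω hω
      exact ((hJt ω hω t).limUnder_eq).symm
  · choose! F hF hF' using hrel
    have hle : ∀ j : ℕ, t ≤ ((j + ⌈t⌉₊ : ℕ) : ℝ≥0) := fun j =>
      (Nat.le_ceil t).trans (by exact_mod_cast Nat.le_add_left _ _)
    refine WienerRel.of_tendsto hpre (fm := fun j => F (j + ⌈t⌉₊) t)
      (Zm := fun j => N (j + ⌈t⌉₊) t) (fun j => hF _ t (hle j)) (memLp_indicator_Ioc hg t) ?_ ?_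
    · have h0 : Tendsto (fun j : ℕ => ENNReal.ofReal ((1 / 8) ^ (j + ⌈t⌉₊))) atTop (𝓝 0) := by
        rw [← ENNReal.ofReal_zero]
        refine (ENNReal.continuous_ofReal.tendsto 0).comp ?_
        exact (tendsto_add_atTop_iff_nat ⌈t⌉₊).2
          (tendsto_pow_atTop_nhds_zero_of_lt_one (by norm_num) (by norm_num))
      exact tendsto_of_tendsto_of_tendsto_of_le_of_le tendsto_const_nhds h0 (fun _ => zero_le)
        fun j => hF' _ t (hle j)
    · filter_upwards [hSae] with ω hω
      exact (tendsto_add_atTop_iff_nat ⌈t⌉₊).2 (hJt ω hω t)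

end ContinuousVersion

/-! ### The matrix exponential: discounted energy and summation by parts. -/

section Flow

variable {n : ℕ}

/-- The flow `e^{tA}`. -/
noncomputable def flow (A : Mat n n) (t : ℝ) : Vec n →L[ℝ] Vec n := NormedSpace.exp (t • actCLM A)

lemma flow_zero (A : Mat n n) : flow A 0 = 1 := by
  have h : (0 : ℝ) • actCLM A = 0 := zero_smul ℝ (actCLM A)
  exact (congrArg NormedSpace.exp h).trans NormedSpace.exp_zero

lemma flow_add (A : Mat n n) (s t : ℝ) : flow A (s + t) = flow A s * flow A t := by
  have h : (s + t) • actCLM A = s • actCLM A + t • actCLM A := add_smul s t (actCLM A)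
  have hc : Commute (s • actCLM A) (t • actCLM A) := by
    refine ContinuousLinearMap.ext fun x => ?_
    change s • actCLM A (t • actCLM A x) = t • actCLM A (s • actCLM A x)
    rw [map_smul, map_smul, smul_comm]
  let _ : NormedAlgebra ℚ (Vec n →L[ℝ] Vec n) := NormedAlgebra.restrictScalars ℚ ℝ _
  exact (congrArg NormedSpace.exp h).trans (NormedSpace.exp_add_of_commute hc)

lemma flow_neg_mul (A : Mat n n) (t : ℝ) : flow A t * flow A (-t) = 1 := by
  rw [← flow_add, add_neg_cancel, flow_zero]

lemma flow_apply_flow_neg (A : Mat n n) (t : ℝ) (x : Vec n) : flow A t (flow A (-t) x) = x := by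
  have := congrArg (fun L : Vec n →L[ℝ] Vec n => L x) (flow_neg_mul A t)
  simpa using this

lemma hasDerivAt_flow (A : Mat n n) (t : ℝ) : HasDerivAt (flow A) (actCLM A * flow A t) t :=
  hasDerivAt_exp_smul_const' (actCLM A) t

lemma continuous_flow (A : Mat n n) : Continuous (flow A) :=
  continuous_iff_continuousAt.2 fun t => (hasDerivAt_flow A t).continuousAt

lemma hasDerivAt_flow_apply (A : Mat n n) (x : Vec n) (t : ℝ) :
    HasDerivAt (fun t => flow A t x) (act A (flow A t x)) t := by
  simpa using (hasDerivAt_flow A t).clm_apply (hasDerivAt_const t x)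

/-- The discounted flow of a matrix `A` with `A - ρ/2` Hurwitz is square integrable. -/
lemma lintegral_flow_le {ρ : ℝ} {A : Mat n n} (hA : IsHurwitz (A - (ρ / 2) • (1 : Mat n n))) :
    ∃ C : ℝ≥0, ∀ x : Vec n, ∫⁻ t in Ici (0 : ℝ),
      ENNReal.ofReal (Real.exp (-ρ * t) * ‖flow A t x‖ ^ 2) ≤ C * ENNReal.ofReal (‖x‖ ^ 2) := by
  obtain ⟨X, hXt, hX1, c, hc, hX2⟩ := hA.exists_lyapunov
  -- The Lyapunov form satisfies `V' ≤ -2c e^{-ρt}‖z‖²`, stays nonnegative and starts at most at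
  -- `‖X‖ ‖x‖²`; integrating gives this constant.
  refine ⟨‖actCLM X‖₊ / (2 * c.toNNReal), fun x => ?_⟩
  set z := fun t => flow A t x with hz
  set V := fun t => Real.exp (-ρ * t) * inner ℝ (act X (z t)) (z t) with hV
  set V' := fun t => Real.exp (-ρ * t) * (2 * inner ℝ (act X (z t))
        (act (A - (ρ / 2) • (1 : Mat n n)) (z t))) with hV'
  have hzd : ∀ t, HasDerivAt z (act A (z t)) t := hasDerivAt_flow_apply A x
  have hVd : ∀ t, HasDerivAt V (V' t) t := by
    intro t
    rw [← hasDerivWithinAt_univ]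
    refine (hasDerivWithinAt_exp_mul ((hasDerivWithinAt_act X (hzd t).hasDerivWithinAt).inner ℝ
      (hzd t).hasDerivWithinAt)).congr_deriv ?_
    simp only [hV']
    congr 1
    rw [inner_act_left X (act A (z t)), hXt, real_inner_comm (act X (z t)) (act A (z t))]
    simp only [act_sub_left, act_smul_left, act_one, inner_sub_right, inner_smul_right]
    ring
  have hV'le : ∀ t, V' t ≤ -(2 * c * (Real.exp (-ρ * t) * ‖z t‖ ^ 2)) := by
    intro t
    have h1 := hX2 (z t)
    have h2 := Real.exp_pos (-ρ * t)
    simp only [hV']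
    nlinarith
  have hV'np : ∀ t, V' t ≤ 0 := fun t => (hV'le t).trans (by
    have : 0 ≤ 2 * c * (Real.exp (-ρ * t) * ‖z t‖ ^ 2) := by positivity
    linarith)
  have hV0 : ∀ t, 0 ≤ V t := fun t =>
    mul_nonneg (Real.exp_nonneg _) ((sq_nonneg _).trans (hX1 (z t)))
  have hanti : Antitone V := antitone_of_hasDerivAt_nonpos hVd hV'np
  have hlim : Tendsto V atTop (𝓝 (⨅ t, V t)) :=
    tendsto_atTop_ciInf hanti ⟨0, by rintro _ ⟨t, rfl⟩; exact hV0 t⟩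
  have hint := integrableOn_Ioi_deriv_of_nonpos (hVd 0).continuousAt.continuousWithinAt
    (fun t _ => hVd t) (fun t _ => hV'np t) hlim
  have hval := integral_Ioi_of_hasDerivAt_of_nonpos (hVd 0).continuousAt.continuousWithinAt
    (fun t _ => hVd t) (fun t _ => hV'np t) hlim
  have hinf : 0 ≤ ⨅ t, V t := le_ciInf hV0
  have hV0le : V 0 ≤ ‖actCLM X‖ * ‖x‖ ^ 2 := by
    simp only [hV, hz, flow_zero]
    have h1 := real_inner_le_norm (act X x) x
    have h2 := norm_act_le X x
    simp only [mul_zero, Real.exp_zero, one_mul, one_apply_eq_self]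
    nlinarith [norm_nonneg x]
  rw [← setLIntegral_congr Ioi_ae_eq_Ici]
  calc ∫⁻ t in Ioi (0 : ℝ), ENNReal.ofReal (Real.exp (-ρ * t) * ‖flow A t x‖ ^ 2)
      ≤ ∫⁻ t in Ioi (0 : ℝ), ENNReal.ofReal (-V' t / (2 * c)) := by
        refine lintegral_mono fun t => ENNReal.ofReal_le_ofReal ?_
        rw [le_div_iff₀ (by positivity)]
        have := hV'le t
        simp only [hz] at this
        linarith
    _ = ENNReal.ofReal (∫ t in Ioi (0 : ℝ), -V' t / (2 * c)) := by
        refine (ofReal_integral_eq_lintegral_ofReal (hint.neg.div_const _)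
          (ae_of_all _ fun t => ?_)).symm
        have := hV'np t
        exact div_nonneg (by simpa using this) (by positivity)
    _ ≤ ENNReal.ofReal (‖actCLM X‖ / (2 * c) * ‖x‖ ^ 2) := by
        refine ENNReal.ofReal_le_ofReal ?_
        rw [integral_div, integral_neg, hval, div_mul_eq_mul_div]
        gcongr
        linarith
    _ = _ := by
        rw [ENNReal.ofReal_mul (by positivity)]
        congr 1
        rw [← ENNReal.ofReal_coe_nnreal]
        congr 1
        push_cast
        rw [Real.coe_toNNReal _ hc.le]

/-- Summation by parts against the flow. -/
lemma tendsto_sum_flow_sub (A : Mat n n) {J : ℝ≥0 → Vec n} (hJ : Continuous J) (hJ0 : J 0 = 0)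
    (t : ℝ≥0) :
    Tendsto (fun m : ℕ => ∑ k ∈ Finset.range (m + 1),
        flow A (grid t m (k + 1)) (J (grid t m (k + 1)) - J (grid t m k))) atTop
      (𝓝 (flow A t (J t) - ∫ s in (0 : ℝ)..t, act A (flow A s (J s.toNNReal)))) := by
  have hJr : Continuous fun s : ℝ => J s.toNNReal := hJ.comp continuous_real_toNNReal
  have hcont : ∀ x : ℝ → Vec n, Continuous x → Continuous fun s => act A (flow A s (x s)) :=
    fun x hx => (continuous_act A).comp ((continuous_flow A).clm_apply hx)
  obtain ⟨C, hC⟩ := isCompact_Icc.exists_bound_of_continuousOn (s := Icc (0 : ℝ) t)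
    (f := fun s => actCLM A * flow A s) (continuous_const.mul (continuous_flow A)).continuousOn
  have hC0 : 0 ≤ C := (norm_nonneg _).trans (hC 0 ⟨le_rfl, t.2⟩)
  rw [Metric.tendsto_atTop]
  intro ε hε
  obtain ⟨m₀, hm₀⟩ := exists_grid_close (g := fun s : ℝ => J s.toNNReal) hJr.continuousOn t
    (ε := ε / (C * t + 1)) (by positivity)
  refine ⟨m₀, fun m hm => ?_⟩
  set τ := grid t m with hτ
  -- The terms `e^{τA} J(τ)` telescope, so the error is an integral over each cell of `A e^{sA}`
  -- applied to the oscillation of `J`, which is uniformly small.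
  have hkey : (∑ k ∈ Finset.range (m + 1), flow A (τ (k + 1)) (J (τ (k + 1)) - J (τ k))) -
      (flow A t (J t) - ∫ s in (0 : ℝ)..t, act A (flow A s (J s.toNNReal))) =
      ∑ k ∈ Finset.range (m + 1), ∫ s in (τ k : ℝ)..τ (k + 1),
        act A (flow A s (J s.toNNReal - J (τ k))) := by
    have h1 : flow A t (J t) = ∑ k ∈ Finset.range (m + 1),
        (flow A (τ (k + 1)) (J (τ (k + 1))) - flow A (τ k) (J (τ k))) := by
      rw [Finset.sum_range_sub (fun k => flow A (τ k) (J (τ k))), hτ, grid_zero, grid_last, hJ0]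
      simp
    have h2 : ∫ s in (0 : ℝ)..t, act A (flow A s (J s.toNNReal)) =
        ∑ k ∈ Finset.range (m + 1), ∫ s in (τ k : ℝ)..τ (k + 1),
          act A (flow A s (J s.toNNReal)) := by
      rw [intervalIntegral.sum_integral_adjacent_intervals (a := fun k => (τ k : ℝ))
        fun k _ => (hcont _ hJr).intervalIntegrable _ _]
      simp only [hτ, grid_zero, grid_last, NNReal.coe_zero]
    rw [h1, h2, ← Finset.sum_sub_distrib, ← Finset.sum_sub_distrib]
    refine Finset.sum_congr rfl fun k _ => ?_
    have h3 : ∫ s in (τ k : ℝ)..τ (k + 1), act A (flow A s (J (τ k))) =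
        flow A (τ (k + 1)) (J (τ k)) - flow A (τ k) (J (τ k)) :=
      intervalIntegral.integral_eq_sub_of_hasDerivAt
        (fun s _ => hasDerivAt_flow_apply A (J (τ k)) s)
        ((hcont _ continuous_const).intervalIntegrable _ _)
    simp only [map_sub]
    rw [intervalIntegral.integral_sub ((hcont _ hJr).intervalIntegrable _ _)
      ((hcont _ continuous_const).intervalIntegrable _ _), h3]
    abel
  rw [dist_eq_norm, hkey]
  have hb : ∀ k ∈ Finset.range (m + 1), ‖∫ s in (τ k : ℝ)..τ (k + 1),
      act A (flow A s (J s.toNNReal - J (τ k)))‖ ≤ C * (ε / (C * t + 1)) * (t / (m + 1)) := by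
    intro k hk
    have hk' : k + 1 ≤ m + 1 := Finset.mem_range.1 hk
    have hle : (τ k : ℝ) ≤ τ (k + 1) := by exact_mod_cast grid_mono t m k.le_succ
    have hT : (τ (k + 1) : ℝ) ≤ t := by exact_mod_cast grid_le t hk'
    have hd := grid_succ_sub t m k
    have := intervalIntegral.norm_integral_le_of_norm_le_const (a := (τ k : ℝ)) (b := τ (k + 1))
      (f := fun s => act A (flow A s (J s.toNNReal - J (τ k)))) (C := C * (ε / (C * t + 1))) ?_
    · rwa [hd, abs_of_nonneg (by positivity)] at this
    · intro s hs
      rw [uIoc_of_le hle] at hs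
      have hs0 : 0 ≤ s := (τ k).2.trans hs.1.le
      have hst : s ≤ t := hs.2.trans hT
      have e1 : act A (flow A s (J s.toNNReal - J (τ k))) =
        (actCLM A * flow A s) (J s.toNNReal - J (τ k)) := rfl
      have e2 := hm₀ m hm s (τ k) ⟨hs0, hst⟩ ⟨(τ k).2, hle.trans hT⟩ (by
        rw [abs_of_nonneg (by linarith [hs.1]), ← hd]
        linarith [hs.2])
      rw [Real.toNNReal_coe] at e2
      rw [e1]
      exact (ContinuousLinearMap.le_opNorm _ _).trans
        (mul_le_mul (hC s ⟨hs0, hst⟩) e2 (norm_nonneg _) hC0)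
  refine (norm_sum_le_of_le _ hb).trans_lt ?_
  rw [Finset.sum_const, Finset.card_range, nsmul_eq_mul]
  push_cast
  have h1 : ((m : ℝ) + 1) * (C * (ε / (C * t + 1)) * (t / (m + 1))) = C * t * ε / (C * t + 1) := by
    field_simp
  rw [h1, div_lt_iff₀ (by positivity)]
  linarith

end Flow

/-! ### Integration by parts for the Wiener integral. -/

section FlowIntegral

variable {Ω : Type*} {m0 : MeasurableSpace Ω} {μ : Measure Ω} {W : ℝ≥0 → Ω → ℝ} {n : ℕ}

/-- Integration by parts: if `J = ∫ e^{-uA} σ dW` then `e^{tA} J(t) - ∫₀ᵗ A e^{sA} J(s) ds` is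
the Wiener integral of `σ`. -/
lemma wienerRel_of_flow (hW : IsPreBrownianReal W μ) (A : Mat n n) {σ : ℝ → Vec n}
    (hσ : ContinuousOn σ (Ici 0)) {J : ℝ≥0 → Ω → Vec n} (hJc : ∀ ω, Continuous fun t => J t ω)
    (hJ0 : ∀ ω, J 0 ω = 0)
    (hJ : ∀ t : ℝ≥0, WienerRel μ W ((Ioc 0 (t : ℝ)).indicator fun u => flow A (-u) (σ u)) (J t))
    (t : ℝ≥0) :
    WienerRel μ W ((Ioc 0 (t : ℝ)).indicator σ)
      fun ω => flow A t (J t ω) - ∫ s in (0 : ℝ)..t, act A (flow A s (J s.toNNReal ω)) := by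
  have hgc : ContinuousOn (fun u => flow A (-u) (σ u)) (Ici 0) :=
    ((continuous_flow A).comp continuous_neg).continuousOn.clm_apply hσ
  obtain ⟨C, hC⟩ := isCompact_Icc.exists_bound_of_continuousOn (s := Icc (0 : ℝ) t)
    (hgc.mono Icc_subset_Ici_self)
  have hC0 : 0 ≤ C := (norm_nonneg _).trans (hC 0 ⟨le_rfl, t.2⟩)
  have hstep : ∀ m k, WienerRel μ W ((Ioc (grid t m k : ℝ) (grid t m (k + 1))).indicator
      fun u => flow A (grid t m (k + 1)) (flow A (-u) (σ u)))
      fun ω => flow A (grid t m (k + 1)) (J (grid t m (k + 1)) ω - J (grid t m k) ω) := by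
    intro m k
    have hab : (grid t m k : ℝ) ≤ grid t m (k + 1) := by exact_mod_cast grid_mono t m k.le_succ
    refine (((hJ (grid t m (k + 1))).sub (hJ (grid t m k))).clm
      (flow A (grid t m (k + 1)))).congr (ae_of_all _ fun u => ?_) EventuallyEq.rfl
    rw [← Ioc_union_Ioc_eq_Ioc (grid t m k).2 hab,
      indicator_union_of_disjoint (Ioc_disjoint_Ioc_of_le le_rfl)]
    by_cases hu : u ∈ Ioc (grid t m k : ℝ) (grid t m (k + 1)) <;>
      simp [hu]
  -- On each cell `e^{(τ-u)A} σ(u)` with `τ` the right endpoint is close to `σ(u)`, giving `L²`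
  -- convergence of the integrands; the integrals converge pathwise by `tendsto_sum_flow_sub`.
  refine WienerRel.of_tendsto hW (fun m => WienerRel.sum fun k (_ : k ∈ Finset.range (m + 1)) =>
    hstep m k) (memLp_indicator_Ioc hσ t) ?_ ?_
  · rw [ENNReal.tendsto_atTop_zero]
    intro ε hε
    obtain ⟨δ, hδ0, hδ⟩ : ∃ δ : ℝ, 0 < δ ∧ ENNReal.ofReal δ ≤ ε := by
      rcases eq_or_ne ε ∞ with rfl | hε'
      · exact ⟨1, one_pos, le_top⟩
      · exact ⟨ε.toReal, ENNReal.toReal_pos hε.ne' hε', ENNReal.ofReal_toReal_le⟩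
    obtain ⟨m₀, hm₀⟩ := exists_grid_close (continuous_flow A).continuousOn t
      (ε := δ / ((C + 1) * (Real.sqrt t + 1))) (by positivity)
    refine ⟨m₀, fun m hm => le_trans ?_ hδ⟩
    have h := eLpNorm_sum_indicator_sub_le (grid_mono t m) (n := m + 1)
      (fun k u => flow A (grid t m (k + 1)) (flow A (-u) (σ u))) σ
      (ε := δ / ((C + 1) * (Real.sqrt t + 1)) * C) (by positivity) ?_
    · rw [grid_zero, grid_last, NNReal.coe_zero] at h
      refine h.trans (ENNReal.ofReal_le_ofReal ?_)
      have hs := Real.sqrt_nonneg t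
      rw [mul_assoc, div_mul_eq_mul_div, div_le_iff₀ (by positivity)]
      have : C * Real.sqrt t ≤ (C + 1) * (Real.sqrt t + 1) := by nlinarith
      nlinarith
    · intro k hk u hu
      have hT : (grid t m (k + 1) : ℝ) ≤ t := by exact_mod_cast grid_le t (by omega)
      have hu0 : 0 ≤ u := (grid t m k).2.trans hu.1.le
      have e1 : flow A (grid t m (k + 1)) (flow A (-u) (σ u)) - σ u =
          (flow A (grid t m (k + 1)) - flow A u) (flow A (-u) (σ u)) := by
        rw [_root_.sub_apply, flow_apply_flow_neg A u]
      have e2 := hm₀ m hm (grid t m (k + 1)) u ⟨by positivity, hT⟩ ⟨hu0, hu.2.trans hT⟩ (by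
        rw [abs_of_nonneg (by linarith [hu.2]), ← grid_succ_sub t m k]
        linarith [hu.1])
      rw [e1]
      exact (ContinuousLinearMap.le_opNorm _ _).trans
        (mul_le_mul e2 (hC u ⟨hu0, hu.2.trans hT⟩) (norm_nonneg _) (by positivity))
  · refine ae_of_all _ fun ω => ?_
    have := tendsto_sum_flow_sub A (hJc ω) (hJ0 ω) t
    refine this.congr fun m => ?_
    simp [Finset.sum_apply]

/-- A continuous process that is related to `1_(0,t] σ` at each time is a Wiener integral of `σ`. -/
lemma isWienerIntegral_of_wienerRel (hW : IsPreBrownianReal W μ) {σ : ℝ → Vec n}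
    (hσ : ContinuousOn σ (Ici 0)) {I : ℝ≥0 → Ω → Vec n}
    (hIc : ∀ᵐ ω ∂μ, Continuous fun t => I t ω)
    (hI : ∀ t : ℝ≥0, WienerRel μ W ((Ioc 0 (t : ℝ)).indicator σ) (I t)) :
    IsWienerIntegral μ σ W I := by
  refine ⟨fun t => (hI t).memLp.1, hIc, fun t => ?_⟩
  rw [ENNReal.tendsto_atTop_zero]
  intro ε hε
  obtain ⟨δ, hδ0, hδ⟩ : ∃ δ : ℝ, 0 < δ ∧ ENNReal.ofReal δ ≤ ε := by
    rcases eq_or_ne ε ∞ with rfl | hε'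
    · exact ⟨1, one_pos, le_top⟩
    · exact ⟨ε.toReal, ENNReal.toReal_pos hε.ne' hε', ENNReal.ofReal_toReal_le⟩
  obtain ⟨m₀, hm₀⟩ := exists_leftSum_approx hW hσ t hδ0
  refine ⟨m₀, fun m hm => ?_⟩
  obtain ⟨F, hF, hF'⟩ := hm₀ m hm t le_rfl
  have h := (hF.sub (hI t)).eLpNorm_eq hW
  refine le_trans (le_of_eq ?_) ((h.trans_le hF').trans hδ)
  congr 1
  ext1 ω
  simp only [Pi.sub_apply, leftSum]
  congr 1
  refine Finset.sum_congr rfl fun k hk => ?_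
  have hk' : k + 1 ≤ m + 1 := Finset.mem_range.1 hk
  rw [min_eq_right (grid_le t hk'), min_eq_right (grid_le t (by omega))]
  simp only [grid]
  push_cast
  rfl

end FlowIntegral

/-! ### Uniqueness of the Wiener integral and of the linear integral equation. -/

section Uniqueness

variable {Ω : Type*} [MeasurableSpace Ω] {μ : Measure Ω} {W : ℝ≥0 → Ω → ℝ} {n : ℕ}

/-- At each time both are `L²` limits of the same sums; continuity extends agreement from a
countable dense set to all times off one null set. -/
lemma IsWienerIntegral.ae_eq {σ : ℝ → Vec n} {I I' : ℝ≥0 → Ω → Vec n}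
    (hm : ∀ t, Measurable (W t)) (h : IsWienerIntegral μ σ W I) (h' : IsWienerIntegral μ σ W I') :
    ∀ᵐ ω ∂μ, ∀ t, I t ω = I' t ω := by
  have key : ∀ t, I t =ᵐ[μ] I' t := by
    intro t
    have hlim := (h.tendsto t).add (h'.tendsto t)
    rw [add_zero] at hlim
    have h0 : eLpNorm (I' t - I t) 2 μ ≤ 0 := by
      refine ge_of_tendsto' hlim fun m => ?_
      have hS : AEStronglyMeasurable (fun ω => ∑ k ∈ Finset.range (m + 1),
          (W (t * ((k : ℝ≥0) + 1) / (m + 1)) ω - W (t * (k : ℝ≥0) / (m + 1)) ω) •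
            σ ((t * (k : ℝ≥0) / (m + 1) : ℝ≥0) : ℝ)) μ := by
        refine (Finset.measurable_sum _ fun k _ => ?_).aestronglyMeasurable
        exact ((hm _).sub (hm _)).smul_const _
      refine le_trans (le_of_eq ?_) (eLpNorm_sub_le (hS.sub (h.aestronglyMeasurable t))
        (hS.sub (h'.aestronglyMeasurable t)) (by norm_num))
      congr 1
      ext1 ω
      simp
    rw [nonpos_iff_eq_zero, eLpNorm_eq_zero_iff ((h'.aestronglyMeasurable t).sub
      (h.aestronglyMeasurable t)) (by norm_num)] at h0
    filter_upwards [h0] with ω hω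
    exact (sub_eq_zero.1 (by simpa using hω)).symm
  have hall := ae_all_iff.2 fun k : ℕ => key (TopologicalSpace.denseSeq ℝ≥0 k)
  filter_upwards [hall, h.continuous, h'.continuous] with ω h1 h2 h3
  have := h2.ext_on (TopologicalSpace.denseRange_denseSeq ℝ≥0) h3 (by rintro _ ⟨k, rfl⟩; exact h1 k)
  exact congrFun this

lemma eq_zero_of_eq_integral {A : Mat n n} {D : ℝ≥0 → Vec n} (hD : Continuous D)
    (h : ∀ t : ℝ≥0, D t = ∫ τ in (0 : ℝ)..t, act A (D τ.toNNReal)) (t : ℝ≥0) : D t = 0 := by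
  have hc : Continuous fun τ : ℝ => act A (D τ.toNNReal) :=
    (continuous_act A).comp (hD.comp continuous_real_toNNReal)
  have h1 := eqOn_zero_of_linear_ode (A := A) (y := fun τ : ℝ => D τ.toNNReal)
    (by rw [Real.toNNReal_zero, h 0]; simp) (fun s hs => by
      have hd := (hc.integral_hasStrictDerivAt 0 s).hasDerivAt.hasDerivWithinAt (s := Ici 0)
      refine hd.congr (fun u hu => ?_) ?_
      · rw [h, Real.coe_toNNReal _ hu]
      · rw [h, Real.coe_toNNReal _ hs])
  simpa using h1 t t.2

end Uniqueness

/-! ### The explicit closed-loop state. -/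

section Agent

variable {n : ℕ}

/-- The state of an agent with closed-loop matrix `A`: the reference trajectory `x` plus the
deviation caused by the initial deviation `v` and by the noise. -/
noncomputable def agentState (A : Mat n n) (x : ℝ → Vec n) (v : Vec n) (J : ℝ≥0 → Vec n)
    (t : ℝ≥0) : Vec n :=
  x t + flow A t (v + J t)

variable {A : Mat n n} {x h : ℝ → Vec n} {v : Vec n} {J : ℝ≥0 → Vec n}

lemma continuous_agentState (hx : ContinuousOn x (Ici 0)) (hJ : Continuous J) :
    Continuous (agentState A x v J) := by
  have h1 : Continuous fun t : ℝ≥0 => x t :=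
    hx.comp_continuous NNReal.continuous_coe fun t => t.2
  exact h1.add (((continuous_flow A).comp NNReal.continuous_coe).clm_apply
    (continuous_const.add hJ))

/-- The part without noise is differentiable and handled by the fundamental theorem of calculus. The
noise part is not; its drift integral is added and subtracted, and the final bracket is what
`wienerRel_of_flow` identifies as the Wiener integral. -/
lemma agentState_eq (hJ : Continuous J) (hh : ContinuousOn h (Ici 0))
    (hx : ∀ t ∈ Ici (0 : ℝ), HasDerivWithinAt x (act A (x t) + h t) (Ici 0) t) (t : ℝ≥0) :
    IntervalIntegrable (fun τ : ℝ => act A (agentState A x v J τ.toNNReal) + h τ) volume 0 t ∧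
    agentState A x v J t = (x 0 + v)
      + (∫ τ in (0 : ℝ)..t, (act A (agentState A x v J τ.toNNReal) + h τ))
      + (flow A t (J t) - ∫ τ in (0 : ℝ)..t, act A (flow A τ (J τ.toNNReal))) := by
  have hxc : ContinuousOn x (Ici 0) := fun t ht => (hx t ht).continuousWithinAt
  have hIcc : uIcc (0 : ℝ) t ⊆ Ici 0 := by
    rw [uIcc_of_le t.coe_nonneg]; exact Icc_subset_Ici_self
  have hA : ContinuousOn (fun τ => act A (x τ + flow A τ v) + h τ) (Ici 0) :=
    ((continuous_act A).comp_continuousOn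
      (hxc.add ((continuous_flow A).clm_apply continuous_const).continuousOn)).add hh
  have hB : Continuous fun τ : ℝ => act A (flow A τ (J τ.toNNReal)) :=
    (continuous_act A).comp ((continuous_flow A).clm_apply (hJ.comp continuous_real_toNNReal))
  have hAi : IntervalIntegrable (fun τ => act A (x τ + flow A τ v) + h τ) volume 0 t :=
    (hA.mono hIcc).intervalIntegrable
  have hBi := hB.intervalIntegrable (μ := volume) 0 t
  have heq : EqOn (fun τ => (act A (x τ + flow A τ v) + h τ) + act A (flow A τ (J τ.toNNReal)))
      (fun τ : ℝ => act A (agentState A x v J τ.toNNReal) + h τ) (uIcc (0 : ℝ) t) := by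
    intro τ hτ
    simp only [agentState, Real.coe_toNNReal _ (hIcc hτ), map_add]
    abel
  have hftc : ∫ τ in (0 : ℝ)..t, (act A (x τ + flow A τ v) + h τ) =
      (x t + flow A t v) - (x 0 + flow A 0 v) := by
    refine intervalIntegral.integral_eq_sub_of_hasDeriv_right
      (f := fun τ => x τ + flow A τ v) ?_ (fun τ hτ => ?_) hAi
    · exact (hxc.mono hIcc).add ((continuous_flow A).clm_apply continuous_const).continuousOn
    · rw [min_eq_left t.coe_nonneg] at hτ
      have h1 := (hx τ hτ.1.le).mono ((Ioi_subset_Ici_self).trans (Ici_subset_Ici.2 hτ.1.le))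
      refine (h1.add (hasDerivAt_flow_apply A v τ).hasDerivWithinAt).congr_deriv ?_
      simp only [map_add]
      abel
  refine ⟨(hAi.add hBi).congr (heq.mono uIoc_subset_uIcc), ?_⟩
  rw [← intervalIntegral.integral_congr heq, intervalIntegral.integral_add hAi hBi, hftc,
    agentState, flow_zero, map_add, one_apply_eq_self]
  abel

end Agent

/-! ### Discounted second moments. -/

section Moments

variable {Ω : Type*} [MeasurableSpace Ω] {μ : Measure Ω} {W : ℝ≥0 → Ω → ℝ} {n : ℕ}

lemma InCrho.lintegral_lt_top {ρ : ℝ} {g : ℝ → Vec n} (hg : InCrho ρ g) :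
    ∫⁻ t in Ici (0 : ℝ), ENNReal.ofReal (Real.exp (-ρ * t) * ‖g t‖ ^ 2) < ∞ :=
  hg.2.lintegral_lt_top

/-- Young's inequality for the discounted convolution of the flow with `σ`. -/
lemma lintegral_flow_conv_lt_top {ρ : ℝ} {A : Mat n n}
    (hA : IsHurwitz (A - (ρ / 2) • (1 : Mat n n))) {σ : ℝ → Vec n} (hσ : InCrho ρ σ) :
    ∫⁻ t in Ici (0 : ℝ), ENNReal.ofReal (Real.exp (-ρ * t)) *
      ∫⁻ u in Ioc 0 t, ENNReal.ofReal (‖flow A (t - u) (σ u)‖ ^ 2) < ∞ := by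
  obtain ⟨C, hC⟩ := lintegral_flow_le hA
  -- Extending `σ` by its value at 0 makes the integrand jointly measurable on the plane without
  -- changing it on positive times.
  set τ : ℝ → Vec n := fun u => σ (max u 0) with hτ
  have hτc : Continuous τ := hσ.1.comp_continuous (by fun_prop) fun u => mem_Ici.2 (le_max_right u 0)
  have hτσ : ∀ u ∈ Ioi (0 : ℝ), τ u = σ u := fun u hu => by
    simp only [hτ, max_eq_left (mem_Ioi.1 hu).le]
  set F : ℝ × ℝ → ℝ≥0∞ := {p : ℝ × ℝ | p.2 ≤ p.1}.indicator fun p =>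
    ENNReal.ofReal (Real.exp (-ρ * p.1) * ‖flow A (p.1 - p.2) (τ p.2)‖ ^ 2) with hF
  have hFm : Measurable F := by
    refine Measurable.indicator ?_ (measurableSet_le measurable_snd measurable_fst)
    have h1 : Continuous fun p : ℝ × ℝ => flow A (p.1 - p.2) (τ p.2) :=
      ((continuous_flow A).comp (by fun_prop)).clm_apply (hτc.comp continuous_snd)
    have h2 : Continuous fun p : ℝ × ℝ => Real.exp (-ρ * p.1) := by fun_prop
    exact (ENNReal.continuous_ofReal.comp (h2.mul (h1.norm.pow 2))).measurable
  calc ∫⁻ t in Ici (0 : ℝ), ENNReal.ofReal (Real.exp (-ρ * t)) *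
        ∫⁻ u in Ioc 0 t, ENNReal.ofReal (‖flow A (t - u) (σ u)‖ ^ 2)
      = ∫⁻ t in Ici (0 : ℝ), ∫⁻ u in Ioi (0 : ℝ), F (t, u) := by
        refine lintegral_congr fun t => ?_
        rw [← lintegral_const_mul' _ _ ENNReal.ofReal_ne_top, ← Ioi_inter_Iic, inter_comm,
          ← Measure.restrict_restrict measurableSet_Iic, ← lintegral_indicator measurableSet_Iic]
        refine setLIntegral_congr_fun measurableSet_Ioi fun u hu => ?_
        by_cases hut : u ≤ t
        · simp [hF, hut, hτσ u hu, ENNReal.ofReal_mul (Real.exp_nonneg _)]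
        · simp [hF, hut]
    _ = ∫⁻ u in Ioi (0 : ℝ), ∫⁻ t in Ici (0 : ℝ), F (t, u) :=
        lintegral_lintegral_swap hFm.aemeasurable
    _ ≤ ∫⁻ u in Ioi (0 : ℝ), C * ENNReal.ofReal (Real.exp (-ρ * u) * ‖σ u‖ ^ 2) := by
        refine setLIntegral_mono' measurableSet_Ioi fun u hu => ?_
        calc ∫⁻ t in Ici (0 : ℝ), F (t, u)
            -- Enlarging to the whole line makes translation by `u` available; `F` vanishes for
            -- times before `u`, so the shifted integrand lives on the half-line again.
            ≤ ∫⁻ t, F (t, u) := setLIntegral_le_lintegral _ _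
          _ = ∫⁻ t, F (t + u, u) := (lintegral_add_right_eq_self (fun t => F (t, u)) u).symm
          _ = ∫⁻ t in Ici (0 : ℝ), ENNReal.ofReal (Real.exp (-ρ * u)) *
                ENNReal.ofReal (Real.exp (-ρ * t) * ‖flow A t (σ u)‖ ^ 2) := by
              rw [← lintegral_indicator measurableSet_Ici]
              refine lintegral_congr fun t => ?_
              by_cases ht : 0 ≤ t
              · simp only [hF, indicator, mem_ofPred_eq, le_add_iff_nonneg_left, ht, if_true,
                  mem_Ici, add_sub_cancel_right, hτσ u hu]
                rw [← ENNReal.ofReal_mul (Real.exp_nonneg _), mul_add, Real.exp_add]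
                congr 1
                ring
              · simp [hF, ht]
          _ ≤ _ := by
              rw [lintegral_const_mul' _ _ ENNReal.ofReal_ne_top,
                ENNReal.ofReal_mul (Real.exp_nonneg _), mul_left_comm]
              gcongr
              exact hC (σ u)
    _ < ∞ := by
        rw [lintegral_const_mul' _ _ ENNReal.coe_ne_top]
        refine ENNReal.mul_lt_top ENNReal.coe_lt_top ?_
        exact (lintegral_mono_set Ioi_subset_Ici_self).trans_lt hσ.lintegral_lt_top

lemma lintegral_sq_norm_eq_eLpNorm {α : Type*} [MeasurableSpace α] {ν : Measure α}
    {E : Type*} [NormedAddCommGroup E] (f : α → E) :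
    ∫⁻ a, ENNReal.ofReal (‖f a‖ ^ 2) ∂ν = eLpNorm f 2 ν ^ 2 := by
  have h := eLpNorm_nnreal_pow_eq_lintegral (f := f) (μ := ν) (p := 2) (by norm_num)
  simp only [NNReal.coe_ofNat, ENNReal.coe_ofNat, ENNReal.rpow_ofNat] at h
  rw [h]
  refine lintegral_congr fun a => ?_
  rw [ENNReal.ofReal_pow (norm_nonneg _), ofReal_norm]

/-- The discounted second moment of the noise part of the state is finite. -/
lemma lintegral_flow_wiener_lt_top [SFinite μ] (hW : IsPreBrownianReal W μ) {ρ : ℝ} {A : Mat n n}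
    (hA : IsHurwitz (A - (ρ / 2) • (1 : Mat n n))) {σ : ℝ → Vec n} (hσ : InCrho ρ σ)
    {J : ℝ≥0 → Ω → Vec n} (hJm : ∀ t, Measurable (J t)) (hJc : ∀ ω, Continuous fun t => J t ω)
    (hJ : ∀ t : ℝ≥0, WienerRel μ W ((Ioc 0 (t : ℝ)).indicator fun u => flow A (-u) (σ u)) (J t)) :
    ∫⁻ ω, ∫⁻ t in Ici (0 : ℝ), ENNReal.ofReal
      (Real.exp (-ρ * t) * ‖flow A t (J t.toNNReal ω)‖ ^ 2) ∂volume ∂μ < ∞ := by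
  have hjoint : Measurable (Function.uncurry J) :=
    measurable_uncurry_of_continuous_of_measurable hJc hJm
  have hmeas : Measurable fun p : Ω × ℝ => ENNReal.ofReal
      (Real.exp (-ρ * p.2) * ‖flow A p.2 (J p.2.toNNReal p.1)‖ ^ 2) := by
    have h1 : Continuous fun q : ℝ × Vec n =>
        ENNReal.ofReal (Real.exp (-ρ * q.1) * ‖flow A q.1 q.2‖ ^ 2) := by
      have h2 : Continuous fun q : ℝ × Vec n => flow A q.1 q.2 :=
        ((continuous_flow A).comp continuous_fst).clm_apply continuous_snd
      have h3 : Continuous fun q : ℝ × Vec n => Real.exp (-ρ * q.1) := by fun_prop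
      exact ENNReal.continuous_ofReal.comp (h3.mul (h2.norm.pow 2))
    exact h1.measurable.comp (measurable_snd.prodMk
      (hjoint.comp ((measurable_real_toNNReal.comp measurable_snd).prodMk measurable_fst)))
  rw [lintegral_lintegral_swap hmeas.aemeasurable]
  refine lt_of_eq_of_lt ?_ (lintegral_flow_conv_lt_top hA hσ)
  refine setLIntegral_congr_fun measurableSet_Ici fun t ht => ?_
  simp only [ENNReal.ofReal_mul (Real.exp_nonneg _)]
  rw [lintegral_const_mul' _ _ ENNReal.ofReal_ne_top]
  congr 1
  -- The isometry: the second moment of `e^{tA} J(t)` is `∫₀ᵗ ‖e^{(t-u)A} σ(u)‖² du`.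
  have h1 := ((hJ t.toNNReal).clm (flow A t)).eLpNorm_eq hW
  rw [lintegral_sq_norm_eq_eLpNorm, h1, ← lintegral_sq_norm_eq_eLpNorm, Real.coe_toNNReal t ht,
    ← lintegral_indicator measurableSet_Ioc]
  refine lintegral_congr fun u => ?_
  by_cases hu : u ∈ Ioc 0 t
  · rw [indicator_of_mem hu, indicator_of_mem hu, sub_eq_add_neg, flow_add]
    rfl
  · rw [indicator_of_notMem hu, indicator_of_notMem hu]
    simp

end Moments

/-! ### The closed loop: trajectory, uniqueness, admissibility. -/

variable {Ω : Type*} [MeasurableSpace Ω] {μ : Measure Ω} {n r N : ℕ}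

/-- Without coupling through `G`, the drift involves only the agent's own state and is affine with
matrix `Ā`. -/
lemma drift_ubreve {M : Model n r} (hG : M.G = 0) (hf : M.f = 0) (P K : Mat n n)
    (x φ : ℝ → Vec n) (i : Fin N) (t : ℝ≥0) (z : Fin N → Vec n) :
    drift M (fun _ => M.ubreve P K x φ) i t z =
      act (M.Abar P) (z i) + -act M.S (act K (x t) + φ t) := by
  simp only [drift, Model.ubreve, hG, hf, act_zero_left, add_zero, Pi.zero_apply, Model.Abar,
    Model.S, act_sub_left, act_mul, map_add, map_neg]
  abel

lemma continuous_ubreve (M : Model n r) (P K : Mat n n) (x φ : ℝ → Vec n) (t : ℝ≥0) :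
    Continuous (M.ubreve P K x φ t) :=
  (((continuous_act _).comp ((continuous_act P).add continuous_const))).neg

/-- The noise terms agree by uniqueness of the Wiener integral and the affine terms cancel, so each
path of the difference solves a homogeneous linear integral equation. -/
lemma IsTrajectory.ae_eq {M : Model n r} (hG : M.G = 0) (hf : M.f = 0) {P K : Mat n n}
    {x φ : ℝ → Vec n} {x0 : Fin N → Ω → Vec n} {W : Fin N → ℝ≥0 → Ω → ℝ}
    (hW : ∀ i t, Measurable (W i t)) {X Y : Fin N → ℝ≥0 → Ω → Vec n}
    (hX : IsTrajectory M μ x0 W (fun _ => M.ubreve P K x φ) X)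
    (hY : IsTrajectory M μ x0 W (fun _ => M.ubreve P K x φ) Y) (i : Fin N) :
    ∀ᵐ ω ∂μ, ∀ t, Y i t ω = X i t ω := by
  obtain ⟨I, hI, hXe⟩ := hX.equation i
  obtain ⟨I', hI', hYe⟩ := hY.equation i
  filter_upwards [hX.continuous i, hY.continuous i, hXe, hYe, hI.ae_eq (hW i) hI'] with
    ω hXc hYc hX' hY' hII t
  refine sub_eq_zero.1 (eq_zero_of_eq_integral (A := M.Abar P)
    (D := fun t => Y i t ω - X i t ω) (hYc.sub hXc) (fun t => ?_) t)
  rw [(hX' t).2, (hY' t).2, hII t, add_sub_add_right_eq_sub, add_sub_add_left_eq_sub,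
    ← intervalIntegral.integral_sub (hY' t).1 (hX' t).1]
  refine intervalIntegral.integral_congr fun τ _ => ?_
  rw [drift_ubreve hG hf, drift_ubreve hG hf]
  exact (add_sub_add_right_eq_sub _ _ _).trans (map_sub (Matrix.toEuclideanLin (M.Abar P)) _ _).symm

/-- The deviation process drives the closed loop under the laws of Huang, Caines and Malhamé. -/
lemma isTrajectory_agentState {M : Model n r} (hG : M.G = 0) (hf : M.f = 0)
    (hσ : ContinuousOn M.σ (Ici 0)) {xbar0 : Vec n} {P K : Mat n n} {x φ : ℝ → Vec n}
    (hK : M.SolvesHCM xbar0 P K x φ) {x0 : Fin N → Ω → Vec n} {W : Fin N → ℝ≥0 → Ω → ℝ}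
    (hW : ∀ i, IsPreBrownianReal (W i) μ) {J : Fin N → ℝ≥0 → Ω → Vec n}
    (hJc : ∀ i ω, Continuous fun t => J i t ω) (hJ0 : ∀ i ω, J i 0 ω = 0)
    (hJa : ∀ i t, ∃ Z, StronglyMeasurable[⨆ s : Iic t, MeasurableSpace.comap (W i s) inferInstance]
      Z ∧ J i t =ᵐ[μ] Z)
    (hJ : ∀ i (t : ℝ≥0), WienerRel μ (W i)
      ((Ioc 0 (t : ℝ)).indicator fun u => flow (M.Abar P) (-u) (M.σ u)) (J i t)) :
    IsTrajectory M μ x0 W (fun _ => M.ubreve P K x φ) fun i t ω =>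
      agentState (M.Abar P) x (x0 i ω - xbar0) (fun t => J i t ω) t := by
  obtain ⟨-, hx, hφ, hx0, hxd, -⟩ := hK
  refine ⟨fun i t => ?_, fun i => ae_of_all _ fun ω => continuous_agentState hx.1 (hJc i ω),
    fun i => ⟨_, isWienerIntegral_of_wienerRel (hW i) hσ (ae_of_all _ fun ω => ?_)
      (wienerRel_of_flow (hW i) (M.Abar P) hσ (hJc i) (hJ0 i) (hJ i)), ae_of_all _ fun ω t => ?_⟩⟩
  · obtain ⟨Z, hZ, hJZ⟩ := hJa i t
    have h0 : StronglyMeasurable[pastSigma x0 W t] (x0 i) :=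
      ((comap_measurable (x0 i)).mono (le_iSup_of_le i le_sup_left) le_rfl).stronglyMeasurable
    have hZ' : StronglyMeasurable[pastSigma x0 W t] Z :=
      hZ.mono (le_iSup_of_le i le_sup_right)
    refine ⟨fun ω => x t + flow (M.Abar P) t (x0 i ω - xbar0 + Z ω), ?_, ?_⟩
    · exact stronglyMeasurable_const.add ((flow (M.Abar P) t).continuous.comp_stronglyMeasurable
        ((h0.sub stronglyMeasurable_const).add hZ'))
    · filter_upwards [hJZ] with ω hω
      simp only [agentState, hω]
  · have h1 : Continuous fun τ : ℝ => act (M.Abar P) (flow (M.Abar P) τ (J i τ.toNNReal ω)) :=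
      (continuous_act _).comp
        ((continuous_flow _).clm_apply ((hJc i ω).comp continuous_real_toNNReal))
    exact (((continuous_flow _).comp NNReal.continuous_coe).clm_apply (hJc i ω)).sub
      ((intervalIntegral.continuous_primitive (fun a b => h1.intervalIntegrable a b) 0).comp
        NNReal.continuous_coe)
  · have hh : ContinuousOn (fun τ => -act M.S (act K (x τ) + φ τ)) (Ici 0) :=
      ((continuous_act _).comp_continuousOn
        (((continuous_act K).comp_continuousOn hx.1).add hφ.1)).neg
    obtain ⟨h1, h2⟩ := agentState_eq (A := M.Abar P) (v := x0 i ω - xbar0) (hJc i ω) hh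
      (fun t ht => (hxd t ht).congr_deriv (sub_eq_add_neg _ _)) t
    have heq : EqOn (fun τ : ℝ => act (M.Abar P) (agentState (M.Abar P) x (x0 i ω - xbar0)
          (fun t => J i t ω) τ.toNNReal) + -act M.S (act K (x τ) + φ τ))
        (fun τ : ℝ => drift M (fun _ => M.ubreve P K x φ) i τ.toNNReal fun j =>
          agentState (M.Abar P) x (x0 j ω - xbar0) (fun t => J j t ω) τ.toNNReal)
        (uIcc (0 : ℝ) t) := by
      intro τ hτ
      rw [uIcc_of_le t.coe_nonneg] at hτ
      dsimp only
      rw [drift_ubreve hG hf, Real.coe_toNNReal _ hτ.1]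
    refine ⟨h1.congr (heq.mono uIoc_subset_uIcc), ?_⟩
    rw [← intervalIntegral.integral_congr heq]
    refine h2.trans ?_
    rw [hx0, add_sub_cancel]

lemma isAdmissible_agentState [IsProbabilityMeasure μ] {M : Model n r}
    (hσ : InCrho M.ρ M.σ) {xbar0 : Vec n}
    {P K : Mat n n} (hA : IsHurwitz (M.Abar P - (M.ρ / 2) • (1 : Mat n n))) {x φ : ℝ → Vec n}
    (hK : M.SolvesHCM xbar0 P K x φ) {x0 : Fin N → Ω → Vec n} {W : Fin N → ℝ≥0 → Ω → ℝ}
    (hW : ∀ i, IsPreBrownianReal (W i) μ) (hx0m : ∀ i, Measurable (x0 i))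
    (hx0 : ∀ i, MemLp (x0 i) 2 μ) {J : Fin N → ℝ≥0 → Ω → Vec n}
    (hJm : ∀ i t, Measurable (J i t)) (hJc : ∀ i ω, Continuous fun t => J i t ω)
    (hJ : ∀ i (t : ℝ≥0), WienerRel μ (W i)
      ((Ioc 0 (t : ℝ)).indicator fun u => flow (M.Abar P) (-u) (M.σ u)) (J i t)) :
    IsAdmissible M μ (fun _ => M.ubreve P K x φ) fun i t ω =>
      agentState (M.Abar P) x (x0 i ω - xbar0) (fun t => J i t ω) t := by
  obtain ⟨-, hx, hφ, -⟩ := hK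
  intro i
  set A := M.Abar P
  refine ⟨fun t => ?_, ?_⟩
  -- The control is a continuous function of the current state, so it is measurable for the agent's
  -- own σ-algebra without completion.
  · exact (continuous_ubreve M P K x φ t).measurable.comp
      ((comap_measurable _).mono (le_iSup_of_le (⟨t, mem_Iic.2 le_rfl⟩ : Iic t) le_rfl) le_rfl)
  set m : ℝ → Vec n := fun t => act P (x t) + (act K (x t) + φ t) with hm
  have hmC : InCrho M.ρ m := (hx.comp_actCLM P).add ((hx.comp_actCLM K).add hφ)
  obtain ⟨C, hC⟩ := lintegral_flow_le hA
  have hflow := lintegral_flow_wiener_lt_top (hW i) hA hσ (hJm i) (hJc i) (hJ i)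
  set c : ℝ := ‖actCLM (M.R⁻¹ * M.Bᵀ)‖ with hc
  set p : ℝ := ‖actCLM P‖ with hp
  -- The 3 comes from squaring a sum of three terms, and `p² + 1` dominates both `p²`, the factor of
  -- the two flow terms, and 1, the factor of `m`.
  set b : ℝ := 3 * c ^ 2 * (p ^ 2 + 1) with hb
  have hbound : ∀ ω, ∀ t ∈ Ici (0 : ℝ), ENNReal.ofReal (Real.exp (-M.ρ * t) *
      ‖M.ubreve P K x φ t.toNNReal (agentState A x (x0 i ω - xbar0)
        (fun t => J i t ω) t.toNNReal)‖ ^ 2) ≤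
      ENNReal.ofReal b * (ENNReal.ofReal (Real.exp (-M.ρ * t) * ‖flow A t (x0 i ω - xbar0)‖ ^ 2) +
        (ENNReal.ofReal (Real.exp (-M.ρ * t) * ‖flow A t (J i t.toNNReal ω)‖ ^ 2) +
          ENNReal.ofReal (Real.exp (-M.ρ * t) * ‖m t‖ ^ 2))) := by
    intro ω t ht
    rw [← ENNReal.ofReal_add (by positivity) (by positivity),
      ← ENNReal.ofReal_add (by positivity) (by positivity), ← ENNReal.ofReal_mul (by positivity)]
    refine ENNReal.ofReal_le_ofReal ?_
    rw [← mul_add, ← mul_add, mul_left_comm]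
    refine mul_le_mul_of_nonneg_left ?_ (Real.exp_nonneg _)
    set y := flow A t (x0 i ω - xbar0)
    set z := flow A t (J i t.toNNReal ω)
    have e : M.ubreve P K x φ t.toNNReal (agentState A x (x0 i ω - xbar0)
        (fun t => J i t ω) t.toNNReal) = -act (M.R⁻¹ * M.Bᵀ) (act P y + act P z + m t) := by
      simp only [Model.ubreve, agentState, Real.coe_toNNReal t ht, map_add, hm, y, z]
      abel_nf
    rw [e, norm_neg]
    have h1 : ‖act (M.R⁻¹ * M.Bᵀ) (act P y + act P z + m t)‖ ≤ c * (p * ‖y‖ + p * ‖z‖ + ‖m t‖) :=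
      (norm_act_le _ _).trans (mul_le_mul_of_nonneg_left (norm_add₃_le.trans
        (add_le_add (add_le_add (norm_act_le P y) (norm_act_le P z)) le_rfl)) (norm_nonneg _))
    have h2 := pow_le_pow_left₀ (norm_nonneg _) h1 2
    refine h2.trans ?_
    rw [mul_pow, hb, mul_assoc, mul_assoc, mul_left_comm]
    refine mul_le_mul_of_nonneg_left ?_ (sq_nonneg c)
    nlinarith [sq_nonneg (p * ‖y‖ - p * ‖z‖), sq_nonneg (p * ‖y‖ - ‖m t‖),
      sq_nonneg (p * ‖z‖ - ‖m t‖), sq_nonneg (p * ‖m t‖), sq_nonneg ‖y‖, sq_nonneg ‖z‖]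
  have hinner : ∀ ω, ∫⁻ t in Ici (0 : ℝ), ENNReal.ofReal (Real.exp (-M.ρ * t) *
      ‖M.ubreve P K x φ t.toNNReal (agentState A x (x0 i ω - xbar0)
        (fun t => J i t ω) t.toNNReal)‖ ^ 2) ≤
      ENNReal.ofReal b * (C * ENNReal.ofReal (‖x0 i ω - xbar0‖ ^ 2) +
        ((∫⁻ t in Ici (0 : ℝ), ENNReal.ofReal
          (Real.exp (-M.ρ * t) * ‖flow A t (J i t.toNNReal ω)‖ ^ 2)) +
        ∫⁻ t in Ici (0 : ℝ), ENNReal.ofReal (Real.exp (-M.ρ * t) * ‖m t‖ ^ 2))) := by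
    intro ω
    have hexp : Continuous fun t => Real.exp (-M.ρ * t) := by fun_prop
    have hcm : ∀ y : ℝ → Vec n, Continuous y → Measurable fun t =>
        ENNReal.ofReal (Real.exp (-M.ρ * t) * ‖flow A t (y t)‖ ^ 2) := fun y hy =>
      (ENNReal.continuous_ofReal.comp
        (hexp.mul (((continuous_flow A).clm_apply hy).norm.pow 2))).measurable
    refine (setLIntegral_mono' measurableSet_Ici (hbound ω)).trans ?_
    rw [lintegral_const_mul' _ _ ENNReal.ofReal_ne_top,
      lintegral_add_left (hcm _ continuous_const),
      lintegral_add_left (hcm (fun t => J i t.toNNReal ω) ((hJc i ω).comp continuous_real_toNNReal))]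
    gcongr
    exact hC _
  refine (lintegral_mono hinner).trans_lt ?_
  rw [lintegral_const_mul' _ _ ENNReal.ofReal_ne_top,
    lintegral_add_left (by fun_prop (disch := exact hx0m i)),
    lintegral_add_right _ measurable_const, lintegral_const_mul' _ _ ENNReal.coe_ne_top,
    lintegral_sq_norm_eq_eLpNorm, lintegral_const, measure_univ, mul_one]
  have hξ : eLpNorm (fun ω => x0 i ω - xbar0) 2 μ < ∞ := ((hx0 i).sub (memLp_const xbar0)).2
  exact ENNReal.mul_lt_top ENNReal.ofReal_lt_top (ENNReal.add_lt_top.2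
    ⟨ENNReal.mul_lt_top ENNReal.coe_lt_top (ENNReal.pow_lt_top hξ),
      ENNReal.add_lt_top.2 ⟨hflow, hmC.lintegral_lt_top⟩⟩)

/-- The laws of Huang, Caines and Malhamé are admissible and generate a unique trajectory. -/
theorem isRepresentation_self [IsProbabilityMeasure μ] {M : Model n r} (hG : M.G = 0)
    (hf : M.f = 0) (hσ : InCrho M.ρ M.σ) {xbar0 : Vec n} {x0 : Fin N → Ω → Vec n}
    {W : Fin N → ℝ≥0 → Ω → ℝ} (hA1 : NoiseAssumption μ xbar0 x0 W) {P K : Mat n n}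
    (hA : IsHurwitz (M.Abar P - (M.ρ / 2) • (1 : Mat n n))) {x φ : ℝ → Vec n}
    (hK : M.SolvesHCM xbar0 P K x φ) :
    IsRepresentation M μ x0 W (fun _ => M.ubreve P K x φ) fun _ => M.ubreve P K x φ := by
  have hg : ContinuousOn (fun u => flow (M.Abar P) (-u) (M.σ u)) (Ici 0) :=
    ((continuous_flow _).comp continuous_neg).continuousOn.clm_apply hσ.1
  choose J hJm hJc hJ0 hJa hJ using fun i =>
    exists_continuous_wienerIntegral (hA1.brownian i) (hA1.measurable_noise i) hg
  have hW := fun i => (hA1.brownian i).toIsPreBrownianReal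
  have hadm := isAdmissible_agentState hσ hA hK hW hA1.measurable_init hA1.memLp_init hJm hJc hJ
  have htraj := isTrajectory_agentState hG hf hσ.1 hK (x0 := x0) hW hJc hJ0 hJa hJ
  have hgen : GeneratesUnique M μ x0 W (fun _ => M.ubreve P K x φ) _ :=
    ⟨htraj, fun Y hY i => htraj.ae_eq hG hf hA1.measurable_noise hY i⟩
  exact ⟨_, hadm, hadm, hgen, hgen, fun i => ae_of_all _ fun ω t => rfl⟩

end MeanFieldLQ

theorem proposition3 {n r N : ℕ} {Ω : Type*} [MeasurableSpace Ω] (μ : Measure Ω)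
    [IsProbabilityMeasure μ] (M : Model n r)
    (hG : M.G = 0) (hf : M.f = 0)
    (hR : M.R.PosDef) (hQ : M.Q.PosSemidef) (hσ : InCrho M.ρ M.σ)
    (hdet : IsDetectable (M.A - (M.ρ / 2) • (1 : Mat n n)) (sqrtMat M.Q))
    (hdet' : IsDetectable (M.A + M.G - (M.ρ / 2) • (1 : Mat n n)) (sqrtMat M.Q * (1 - M.Γ)))
    (xbar0 : Vec n) (x0 : Fin N → Ω → Vec n) (W : Fin N → ℝ≥0 → Ω → ℝ)
    (hA1 : NoiseAssumption μ xbar0 x0 W)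
    (P Pi : Mat n n) (hPpos : P.PosSemidef) (hP : M.RiccatiP P)
    (hPipos : Pi.PosSemidef) (hPi : M.RiccatiPi Pi)
    (s xbar : ℝ → Vec n) (hs : M.SolvesMeanField xbar0 Pi s xbar)
    (K : Mat n n) (xdag φ : ℝ → Vec n) (hK : M.SolvesHCM xbar0 P K xdag φ) :
    M.SolvesHCM xbar0 P (Pi - P) xbar s ∧
    ((P + K).PosSemidef ∨ IsHurwitz (M.A - M.S * (P + K) - (M.ρ / 2) • (1 : Mat n n)) →
      K = Pi - P ∧ EqOn φ s (Ici 0)) ∧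
    EqOn xdag xbar (Ici 0) ∧
    IsRepresentation M μ x0 W (fun _ => M.uhat P Pi xbar s) (fun _ => M.ubreve P K xdag φ) := by
  have hSt := transpose_eq_of_posSemidef (M.posSemidef_S hR)
  have hPt := transpose_eq_of_posSemidef hPpos
  have hPit := transpose_eq_of_posSemidef hPipos
  have hA := M.isHurwitz_Abar hR hQ hdet hPpos hP
  have hKt := M.transpose_eq_of_solvesHCM hSt hA (transpose_eq_of_posSemidef hQ) hK.1
  have hDt : (Pi - P)ᵀ = Pi - P := by rw [Matrix.transpose_sub, hPit, hPt]
  have hsol := M.solvesHCM_of_solvesMeanField hG hf hPt hPit hSt hP hPi hs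
  obtain ⟨hx, hu⟩ := M.solvesHCM_unique hR hQ hP hPt hKt hDt hK hsol
  refine ⟨hsol, fun hor => ?_, hx, ?_⟩
  · rw [hG, add_zero] at hdet'
    have hYK := M.riccati_add hP hPt hKt hSt hK.1
    have hYPi : M.ρ • Pi = M.Aᵀ * Pi + Pi * M.A - Pi * M.S * Pi + M.Qhat := by
      have := hPi
      rwa [Model.RiccatiPi, hG, add_zero] at this
    -- Detectability turns the semidefinite alternative into the Hurwitz one, so only the latter has
    -- to be treated.
    have hHK : IsHurwitz (M.A - M.S * (P + K) - (M.ρ / 2) • (1 : Mat n n)) :=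
      hor.elim (fun h => M.isHurwitz_closedLoop hR hQ hdet' h hYK) id
    have hHPi := M.isHurwitz_closedLoop hR hQ hdet' hPipos hYPi
    have hKPi : K = Pi - P := by
      rw [← M.riccati_unique (by rw [Matrix.transpose_add, hPt, hKt]) hSt hYK hYPi hHK hHPi,
        add_sub_cancel_left]
    refine ⟨hKPi, fun t ht => sub_eq_zero.1 ?_⟩
    obtain ⟨-, -, hφ, -, -, hφd⟩ := hK
    obtain ⟨-, -, hsC, -, -, hsd⟩ := hsol
    -- With `K = Pi - P` both functions satisfy the same inhomogeneous equation, so their difference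
    -- solves the homogeneous adjoint one.
    refine eqOn_zero_of_adjoint hHK (hφ.sub hsC) (fun t ht =>
      ((hφd t ht).sub (hsd t ht)).congr_deriv ?_) t ht
    rw [← hKPi]
    simp only [Matrix.transpose_sub, Matrix.transpose_smul, Matrix.transpose_one, act_sub_left,
      act_smul_left, act_one]
    simp only [map_sub, smul_sub]
    abel
  -- The two laws are the same function, so it suffices that one law represents itself.
  · rw [M.uhat_eq_ubreve, ← hu]
    exact isRepresentation_self hG hf hσ hA1 hA hK
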